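/- Let $\Pi$ be a problem in which every instance $I$ explicitly lists a finite base set $\mathcal B(I)$ with $|\mathcal B(I)|\ge 2$ (so the encoding length $|I|$ is at least $|\mathcal B(I)|$) and has a family of solutions $\mathcal R(I)\subseteq 2^{\mathcal B(I)}$; base sets of different instances may overlap. Let $r(I)\in\mathbb N_0$ be a parameter of the instances. In the problem 4-Colored Exact $\Pi$ one is given an instance $I$ of $\Pi$, a coloring $c\colon\mathcal B(I)\to\{1,2,3,4\}$ and $n_1,\dots,n_4\in\mathbb N_0$, and has to output some $S\in\mathcal R(I)$ with $|\{x\in S : c(x)=i\}|=n_i$ for all $i$, or "no" if there is none. In Diverse Multistage $\Pi$ one is given a sequence $I_1,\dots,I_\tau$ ($\tau\ge1$) of instances of $\Pi$ and $\ell\in\mathbb N_0$, and has to decide whether there are $S_i\in\mathcal R(I_i)$ with $|S_i\,\Delta\,S_{i+1}|\ge\ell$ for all $1\le i<\tau$. An algorithm with error probability $p$ is a randomized algorithm whose output is correct with probability at least $1-p$; running times are worst-case over the coin tosses. An algorithm that works for various error bounds $p\in[0,1]$ receives the desired bound as part of its input, as the symbol $0$ if $p=0$ and as the number $\lceil\log_2(1/p)\rceil$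 in unary otherwise; this part of the input is not counted in the input size. Let $f\colon\mathbb N_0\to\mathbb R_{\ge0}$ be non-decreasing, and let $g\colon D\to\mathbb R_{\ge 0}$ be non-increasing, where $D\subseteq[0,1]$ contains with every $p$ all of $[p,1]$. Suppose that there is an algorithm that, for every $p\in D$, solves every instance $I'$ of 4-Colored Exact $\Pi$, with underlying instance $I$ of $\Pi$, with error probability $p$ in time $f(r(I))\cdot|I'|^{O(1)}\cdot g(p)$. Then there is an algorithm that, for every $p\in[0,1]$, solves every instance of Diverse Multistage $\Pi$ of size $n$, with sequence $I_1,\dots,I_\tau$ and diversity $\ell$, with error probability $p$ in time $$2^{O(\ell)}\cdot f(r_{\max})\cdot n^{O(1)}\cdot g\!\left(\frac{p}{\tau\,2^{O(\ell)}\,n^{O(1)}}\right),\qquad r_{\max}=\max_{1\le i\le\tau} r(I_i),$$ whenever the argument of $g$ lies in $D$. The constants hidden in the $O(\cdot)$ do not depend on $p$, $\tau$, $\ell$ or the instances. -/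

import Mathlib

open scoped NNReal

namespace DiverseMultistage

/-! # The machine model

Programs manipulate binary trees (cons cells) and may toss fair coins. Every elementary operation
(producing `nil`, building one cell, following one pointer, one test against `nil`, one coin toss,
one sequencing step) costs one step. This is the usual structured pointer machine, also known as
the while-language over trees, and is equivalent to Turing machines and random access machines
up to polynomial factors in the running time. -/

/-- The values of the machine. -/
inductive Data : Type
  | nil : Data
  | cons : Data → Data → Data
  deriving DecidableEq

namespace Data

/-- The number of nodes of a tree; this is the length of an encoded input. -/
def size : Data → ℕ
  | nil => 1
  | cons a b => a.size + b.size + 1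

/-- First component of a cell. -/
def head : Data → Data
  | nil => nil
  | cons a _ => a

/-- Second component of a cell. -/
def tail : Data → Data
  | nil => nil
  | cons _ b => b

/-- Lists as chains of cells. -/
def ofList : List Data → Data
  | [] => nil
  | a :: l => cons a (ofList l)

/-- Natural numbers in unary. -/
def ofNat : ℕ → Data
  | 0 => nil
  | m + 1 => cons nil (ofNat m)

/-- Truth values: `nil` is false, anything else counts as true. -/
def ofBool : Bool → Data
  | false => nil
  | true => cons nil nil

end Data

/-- Randomized programs. A program transforms one tree into another one. -/
inductive Prog : Type
  /-- return the input -/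
  | ident : Prog
  /-- return `nil` -/
  | nil : Prog
  /-- first component of the input -/
  | head : Prog
  /-- second component of the input -/
  | tail : Prog
  /-- toss a fair coin -/
  | flip : Prog
  /-- run both programs on the input and build a cell from the results -/
  | cons : Prog → Prog → Prog
  /-- `seq p q`: first `p`, then `q` on its result -/
  | seq : Prog → Prog → Prog
  /-- `ite c p q`: if `c` does not return `nil` on the input, continue with `p` on the input,
  otherwise with `q` on the input -/
  | ite : Prog → Prog → Prog → Prog
  /-- `loop c p`: as long as `c` does not return `nil` on the current tree, apply `p` to it -/
  | loop : Prog → Prog → Prog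

/-- `Run P x μ`: on input `x` the program `P` halts for all outcomes of its coin tosses, and
`μ` is the joint distribution of its output and its number of steps. -/
inductive Run : Prog → Data → PMF (Data × ℕ) → Prop
  | ident (x : Data) : Run Prog.ident x (PMF.pure (x, 1))
  | nil (x : Data) : Run Prog.nil x (PMF.pure (Data.nil, 1))
  | head (x : Data) : Run Prog.head x (PMF.pure (x.head, 1))
  | tail (x : Data) : Run Prog.tail x (PMF.pure (x.tail, 1))
  | flip (x : Data) :
      Run Prog.flip x ((PMF.uniformOfFintype Bool).map fun b => (Data.ofBool b, 1))
  | cons {p q : Prog} {x : Data} {μ ν : PMF (Data × ℕ)} : Run p x μ → Run q x ν →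
      Run (Prog.cons p q) x
        (μ.bind fun a => ν.map fun b => (Data.cons a.1 b.1, a.2 + b.2 + 1))
  | seq {p q : Prog} {x : Data} {μ : PMF (Data × ℕ)} {ν : Data → PMF (Data × ℕ)} :
      Run p x μ → (∀ a ∈ μ.support, Run q a.1 (ν a.1)) →
      Run (Prog.seq p q) x
        (μ.bind fun a => (ν a.1).map fun b => (b.1, a.2 + b.2 + 1))
  | ite {c p q : Prog} {x : Data} {μ : PMF (Data × ℕ)} {ν : Data → PMF (Data × ℕ)} :
      Run c x μ →
      (∀ a ∈ μ.support, a.1 ≠ Data.nil → Run p x (ν a.1)) →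
      (∀ a ∈ μ.support, a.1 = Data.nil → Run q x (ν a.1)) →
      Run (Prog.ite c p q) x
        (μ.bind fun a => (ν a.1).map fun b => (b.1, a.2 + b.2 + 1))
  | loop {c p : Prog} {x : Data} {μ : PMF (Data × ℕ)} :
      Run (Prog.ite c (Prog.seq p (Prog.loop c p)) Prog.ident) x μ →
      Run (Prog.loop c p) x μ

/-- On input `x` the program `P` makes at most `T` steps, whatever its coins show, and with
probability at least `1 - p` its output is correct. -/
def MonteCarlo (P : Prog) (x : Data) (correct : Data → Prop) (p : ℝ) (T : ℝ≥0) : Prop :=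
  ∃ μ : PMF (Data × ℕ), Run P x μ ∧
    (∀ a ∈ μ.support, (a.2 : ℝ≥0) ≤ T) ∧
    1 - p ≤ (μ.toOuterMeasure {a | correct a.1}).toReal

/-- How a real number `p ∈ [0, 1]` is handed to a program that is to err with probability at
most `p`: the value `0` has a code of its own, and `p > 0` is given by its order of magnitude,
the number `⌈log₂ (1 / p)⌉`. -/
noncomputable def errorCode (p : ℝ) : Data :=
  if p = 0 then Data.nil else Data.cons Data.nil (Data.ofNat ⌈Real.logb 2 (1 / p)⌉₊)

/-! # The computational problems -/

/-- The description of an instance: a list of the elements of its base set, which has at least two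
elements, and any further data. Elements are named by trees, so that the base sets of
different instances may overlap. -/
structure Inst where
  base : List Data
  nodup : base.Nodup
  two_le : 2 ≤ base.length
  data : Data

/-- The base set of an instance. -/
def Inst.baseSet (I : Inst) : Finset Data := I.base.toFinset

/-- The encoding of an instance. -/
def Inst.code (I : Inst) : Data := Data.cons (Data.ofList I.base) I.data

/-- A problem: which descriptions are instances, and for each instance its family of
solutions, which are subsets of the base set. The question is whether the family is non-empty. -/
structure Problem where
  instances : Set Inst
  solutions : Inst → Set (Finset Data)
  subset_base : ∀ I ∈ instances, ∀ S ∈ solutions I, S ⊆ I.baseSet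

/-- The subset `S` is a solution of `I` with exactly `n i` elements of each color `i`. -/
def IsColoredSolution (Pb : Problem) (I : Inst) (c : Data → Fin 4) (n : Fin 4 → ℕ)
    (S : Finset Data) : Prop :=
  S ∈ Pb.solutions I ∧ ∀ i : Fin 4, (S.filter fun x => c x = i).card = n i

/-- The encoding of an instance of the colored problem: the instance, the colors of
the elements of its base set in the order in which they are listed, and the four numbers. -/
def coloredCode (I : Inst) (c : Data → Fin 4) (n : Fin 4 → ℕ) : Data :=
  Data.cons I.code
    (Data.cons (Data.ofList (I.base.map fun x => Data.ofNat (c x : ℕ)))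
      (Data.ofList (List.ofFn fun i => Data.ofNat (n i))))

/-- Correct outputs for the colored problem: a list without repetitions of the
elements of a colored solution (preceded by a marker), or `nil`, meaning "no", if there is none. -/
def IsColoredAnswer (Pb : Problem) (I : Inst) (c : Data → Fin 4) (n : Fin 4 → ℕ)
    (out : Data) : Prop :=
  (∃ L : List Data, L.Nodup ∧ IsColoredSolution Pb I c n L.toFinset ∧
      out = Data.cons Data.nil (Data.ofList L)) ∨
    ((¬ ∃ S, IsColoredSolution Pb I c n S) ∧ out = Data.nil)

/-- There are solutions `S i` of the instances `I i` such that any two consecutive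
ones have a symmetric difference of size at least `l`. -/
def IsDiverseYes (Pb : Problem) {τ : ℕ} (I : Fin τ → Inst) (l : ℕ) : Prop :=
  ∃ S : Fin τ → Finset Data, (∀ i, S i ∈ Pb.solutions (I i)) ∧
    ∀ i j : Fin τ, (j : ℕ) = i + 1 → l ≤ (symmDiff (S i) (S j)).card

/-- The encoding of an instance of the multistage problem. -/
def multistageCode {τ : ℕ} (I : Fin τ → Inst) (l : ℕ) : Data :=
  Data.cons (Data.ofList (List.ofFn fun i => (I i).code)) (Data.ofNat l)

/-- Correct outputs for the multistage problem: the truth value of "this is a yes-instance". -/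
def IsDiverseAnswer (Pb : Problem) {τ : ℕ} (I : Fin τ → Inst) (l : ℕ) (out : Data) : Prop :=
  (IsDiverseYes Pb I l ∧ out = Data.ofBool true) ∨
    (¬ IsDiverseYes Pb I l ∧ out = Data.ofBool false)

end DiverseMultistage

/-!
# Diverse multistage problems from four-colored exact problems

**Splitting a symmetric difference.** For any set `P` of elements, the symmetric difference of `S`
and `S'` has at least `||S ∩ P| - |S' ∩ P|| + ||S \ P| - |S' \ P||` elements
(`le_card_symmDiff`). So it is enough to have a family of sets such that, whenever the symmetric
difference has at least `l` elements, some `P` in the family makes this bound at least `l`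
(`exists_mem_signFamily`). Given such a family, the solutions of consecutive stages interact only
through numbers: a stage with the set `a` towards the stage before and the set `b` towards the
stage after needs a solution with prescribed numbers of elements inside and outside of `a` and `b`.
That is one instance of the colored problem, where the color of an element tells in which of `a`
and `b` it lies. All these instances are solved first (`mc_callAllProg`), and then a dynamic program
over the stages decides the question (`decideDiverse_iff`).

**The family.** Its size has to be `2 ^ O(l) * n ^ O(1)`, and it must not depend on chance, since the
error bound may be `0`. It comes from a sample space of signs with small bias: if the product of the
signs over every nonempty set of elements has a tiny average, then for every signed set `W` of at
least `l` elements some sign vector correlates with it by at least `l`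
(`exists_large_signed_sum`). To see this, fix `X ⊆ W` with `l` elements, multiply the indicator of
the sign vectors that agree on `X` by one plus the signed sum over `W \ X`, and expand into
characters. Were the claim false, this function would be nonpositive everywhere, but its average is
positive. The sample space is the powering construction: the `i`-th sign is
`(-1) ^ ⟨y, a ^ i⟩` for bit vectors `a` and `y`. Multiplication takes place in `F₂[z] / (z ^ M - 1)`
with `M = 3 ^ (k + 1)`, where it consists of cyclic shifts and additions, so that no irreducible
polynomial has to be found. This ring maps to the field of `M`-th roots of unity, which has degree
`2 * M / 3` over `F₂` because `2` is a primitive root modulo powers of three (`exists_field`). A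
nonzero polynomial has few roots there, so the bias is small (`bias_le`).

**Programs.** Only the number `2 ^ l` is computed in exponential time (`exists_powProg`). All other
deterministic parts are polynomial time functions of the input together with this number, and the
predicate `PT` with its closure properties provides the programs and their bounds.

**Errors and time.** With at most `2 ^ m` calls, the error bound `2 ^ (-m) * p` per call is enough. Its
code arises from the code of `p` by prepending `m` cells, in time independent of `p`
(`exists_lower`). Every call takes at least one step, so the time bound of a single call is at
least `1`, and it can be multiplied to all other costs (`MonteCarlo.one_le`).
-/

open scoped ENNReal

namespace DiverseMultistage

/-! ### Encodings and polynomial bounds -/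

/-- Types whose elements are represented by trees. The representation is injective, so that
equality of elements is equality of trees. -/
class Enc (α : Type) where
  enc : α → Data
  inj : Function.Injective enc

open Enc

theorem ofNat_injective : Function.Injective Data.ofNat := by
  intro a
  induction a with
  | zero => intro b h; cases b <;> simp_all [Data.ofNat]
  | succ a ih =>
    intro b h
    cases b with
    | zero => simp [Data.ofNat] at h
    | succ b => simp only [Data.ofNat, Data.cons.injEq, true_and] at h; rw [ih h]

theorem ofList_injective : Function.Injective Data.ofList := by
  intro a
  induction a with
  | nil => intro b h; cases b <;> simp_all [Data.ofList]
  | cons x a ih =>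
    intro b h
    cases b with
    | nil => simp [Data.ofList] at h
    | cons y b => simp only [Data.ofList, Data.cons.injEq] at h; rw [h.1, ih h.2]

variable {α β γ δ σ : Type}

instance : Enc Data := ⟨id, Function.injective_id⟩
instance : Enc ℕ := ⟨Data.ofNat, ofNat_injective⟩
instance : Enc Bool := ⟨Data.ofBool, by intro a b; cases a <;> cases b <;> simp [Data.ofBool]⟩
instance [Enc α] : Enc (List α) :=
  ⟨fun l => Data.ofList (l.map enc),
    ofList_injective.comp (List.map_injective_iff.2 inj)⟩
instance [Enc α] [Enc β] : Enc (α × β) :=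
  ⟨fun a => Data.cons (enc a.1) (enc a.2), by
    rintro ⟨a, b⟩ ⟨c, d⟩ h
    simp only [Data.cons.injEq] at h
    rw [inj h.1, inj h.2]⟩

variable [Enc α] [Enc β] [Enc γ] [Enc δ] [Enc σ]

@[simp] theorem enc_pair (a : α) (b : β) : enc (a, b) = Data.cons (enc a) (enc b) := rfl
@[simp] theorem enc_nil : enc ([] : List α) = Data.nil := rfl
@[simp] theorem enc_cons (a : α) (l : List α) : enc (a :: l) = Data.cons (enc a) (enc l) := rfl
@[simp] theorem enc_zero : enc (0 : ℕ) = Data.nil := rfl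
@[simp] theorem enc_succ (n : ℕ) : enc (n + 1) = Data.cons Data.nil (enc n) := rfl
@[simp] theorem enc_true : enc true = Data.cons Data.nil Data.nil := rfl
@[simp] theorem enc_false : enc false = Data.nil := rfl
@[simp] theorem enc_data (x : Data) : enc x = x := rfl

/-- The number of nodes of the tree representing an element. -/
def sz (a : α) : ℕ := (enc a).size

theorem sz_def (a : α) : sz a = (enc a).size := rfl

theorem Data.size_pos (x : Data) : 1 ≤ x.size := by cases x <;> simp [Data.size]

theorem sz_pos (a : α) : 1 ≤ sz a := Data.size_pos _

@[simp] theorem sz_pair (a : α) (b : β) : sz (a, b) = sz a + sz b + 1 := rfl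
@[simp] theorem sz_nil : sz ([] : List α) = 1 := rfl
@[simp] theorem sz_cons (a : α) (l : List α) : sz (a :: l) = sz a + sz l + 1 := rfl

@[simp] theorem sz_nat (n : ℕ) : sz n = 2 * n + 1 := by
  induction n with
  | zero => rfl
  | succ n ih => simp only [sz, enc_succ, Data.size] at *; omega

theorem sz_bool (b : Bool) : sz b ≤ 3 := by cases b <;> simp [sz, Data.size]

theorem sz_append (l m : List α) : sz (l ++ m) + 1 = sz l + sz m := by
  induction l with
  | nil => simp; omega
  | cons a l ih => simp only [List.cons_append, sz_cons]; omega

theorem sz_reverse (l : List α) : sz l.reverse = sz l := by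
  induction l with
  | nil => rfl
  | cons a l ih =>
    have := sz_append l.reverse [a]
    simp only [List.reverse_cons, sz_cons, sz_nil] at *; omega

theorem length_le_sz (l : List α) : l.length ≤ sz l := by
  induction l with
  | nil => simp
  | cons a l ih => simp only [List.length_cons, sz_cons]; omega

theorem sz_le_of_mem {a : α} {l : List α} (h : a ∈ l) : sz a ≤ sz l := by
  induction l with
  | nil => simp at h
  | cons b l ih =>
    rcases List.mem_cons.1 h with rfl | h
    · simp only [sz_cons]; omega
    · have := ih h; simp only [sz_cons]; omega

theorem sz_le_of_sublist {l m : List α} (h : l.Sublist m) : sz l ≤ sz m := by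
  induction h with
  | slnil => simp
  | cons a _ ih => simp only [sz_cons]; omega
  | cons_cons a _ ih => simp only [sz_cons]; omega

theorem sz_le_of_forall {l : List α} {B : ℕ} (h : ∀ a ∈ l, sz a ≤ B) :
    sz l ≤ l.length * (B + 1) + 1 := by
  induction l with
  | nil => simp
  | cons a l ih =>
    have h1 := ih fun x hx => h x (List.mem_cons_of_mem _ hx)
    have h2 := h a List.mem_cons_self
    simp only [sz_cons, List.length_cons, Nat.add_mul]; omega

/-- `PB t`: the function `t` is bounded by a polynomial in the size of its argument. -/
def PB (t : α → ℕ) : Prop := ∃ c, ∀ a, t a ≤ (sz a + 1) ^ c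

theorem PB.mono {t u : α → ℕ} (h : PB u) (htu : ∀ a, t a ≤ u a) : PB t :=
  let ⟨c, hc⟩ := h
  ⟨c, fun a => (htu a).trans (hc a)⟩

theorem PB.size : PB (fun a : α => sz a) := ⟨1, fun a => by simp⟩

theorem PB.const (k : ℕ) : PB (fun _ : α => k) := by
  refine ⟨k, fun a => ?_⟩
  calc k ≤ 2 ^ k := Nat.lt_two_pow_self.le
    _ ≤ _ := Nat.pow_le_pow_left (by have := sz_pos a; omega) _

theorem PB.mul {t u : α → ℕ} (ht : PB t) (hu : PB u) : PB (fun a => t a * u a) := by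
  obtain ⟨c, hc⟩ := ht
  obtain ⟨d, hd⟩ := hu
  exact ⟨c + d, fun a => by rw [pow_add]; exact Nat.mul_le_mul (hc a) (hd a)⟩

theorem PB.add {t u : α → ℕ} (ht : PB t) (hu : PB u) : PB (fun a => t a + u a) := by
  obtain ⟨c, hc⟩ := ht
  obtain ⟨d, hd⟩ := hu
  refine ⟨c + d + 1, fun a => ?_⟩
  have h2 : 2 ≤ sz a + 1 := by have := sz_pos a; omega
  have h1 : (sz a + 1) ^ c ≤ (sz a + 1) ^ (c + d) := Nat.pow_le_pow_right (by omega) (by omega)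
  have h3 : (sz a + 1) ^ d ≤ (sz a + 1) ^ (c + d) := Nat.pow_le_pow_right (by omega) (by omega)
  calc t a + u a ≤ (sz a + 1) ^ (c + d) * 2 := by have := hc a; have := hd a; omega
    _ ≤ _ := by rw [pow_succ]; exact Nat.mul_le_mul_left _ h2

theorem PB.pow {t : α → ℕ} (ht : PB t) (k : ℕ) : PB (fun a => t a ^ k) := by
  obtain ⟨c, hc⟩ := ht
  exact ⟨c * k, fun a => by rw [pow_mul]; exact Nat.pow_le_pow_left (hc a) k⟩

theorem PB.comp {t : β → ℕ} {f : α → β} (ht : PB t) (hf : PB fun a => sz (f a)) :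
    PB (fun a => t (f a)) := by
  obtain ⟨c, hc⟩ := ht
  exact ((hf.add (.const 1)).pow c).mono fun a => hc (f a)

/-! ### Deterministic computations -/

/-- On input `x` the program `P` outputs `y` after at most `t` steps, without tossing coins. -/
def Det (P : Prog) (x y : Data) (t : ℕ) : Prop := ∃ k ≤ t, Run P x (PMF.pure (y, k))

theorem Det.mono {P : Prog} {x y : Data} {t u : ℕ} (h : Det P x y t) (htu : t ≤ u) :
    Det P x y u :=
  let ⟨k, hk, hr⟩ := h
  ⟨k, hk.trans htu, hr⟩

theorem Det.ident (x : Data) : Det .ident x x 1 := ⟨1, le_rfl, .ident x⟩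
theorem Det.nil (x : Data) : Det .nil x .nil 1 := ⟨1, le_rfl, .nil x⟩
theorem Det.head (x : Data) : Det .head x x.head 1 := ⟨1, le_rfl, .head x⟩
theorem Det.tail (x : Data) : Det .tail x x.tail 1 := ⟨1, le_rfl, .tail x⟩

theorem Det.cons {p q : Prog} {x y z : Data} {t u : ℕ} (hp : Det p x y t) (hq : Det q x z u) :
    Det (.cons p q) x (.cons y z) (t + u + 1) := by
  obtain ⟨k, hk, hp⟩ := hp
  obtain ⟨m, hm, hq⟩ := hq
  refine ⟨k + m + 1, by omega, ?_⟩
  have := Run.cons hp hq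
  simpa [PMF.pure_map, PMF.pure_bind] using this

theorem Det.seq {p q : Prog} {x y z : Data} {t u : ℕ} (hp : Det p x y t) (hq : Det q y z u) :
    Det (.seq p q) x z (t + u + 1) := by
  obtain ⟨k, hk, hp⟩ := hp
  obtain ⟨m, hm, hq⟩ := hq
  refine ⟨k + m + 1, by omega, ?_⟩
  have := Run.seq (ν := fun _ => PMF.pure (z, m)) hp (by simpa using hq)
  simpa [PMF.pure_map, PMF.pure_bind] using this

theorem Det.ite_true {c p q : Prog} {x y z : Data} {t u : ℕ} (hc : Det c x y t)
    (hy : y ≠ .nil) (hp : Det p x z u) : Det (.ite c p q) x z (t + u + 1) := by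
  obtain ⟨k, hk, hc⟩ := hc
  obtain ⟨m, hm, hp⟩ := hp
  refine ⟨k + m + 1, by omega, ?_⟩
  have := Run.ite (q := q) (ν := fun _ => PMF.pure (z, m)) hc (by simpa [hy] using hp) (by simp [hy])
  simpa [PMF.pure_map, PMF.pure_bind] using this

theorem Det.ite_false {c p q : Prog} {x z : Data} {t u : ℕ} (hc : Det c x .nil t)
    (hq : Det q x z u) : Det (.ite c p q) x z (t + u + 1) := by
  obtain ⟨k, hk, hc⟩ := hc
  obtain ⟨m, hm, hq⟩ := hq
  refine ⟨k + m + 1, by omega, ?_⟩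
  have := Run.ite (p := p) (ν := fun _ => PMF.pure (z, m)) hc (by simp) (by simpa using hq)
  simpa [PMF.pure_map, PMF.pure_bind] using this

theorem Det.loop {c p : Prog} {x y : Data} {t : ℕ}
    (h : Det (.ite c (.seq p (.loop c p)) .ident) x y t) : Det (.loop c p) x y t :=
  let ⟨k, hk, hr⟩ := h
  ⟨k, hk, .loop hr⟩

/-- The program that outputs a fixed tree. -/
def constProg : Data → Prog
  | .nil => .nil
  | .cons a b => .cons (constProg a) (constProg b)

theorem det_constProg (d x : Data) : Det (constProg d) x d d.size := by
  induction d with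
  | nil => exact Det.nil x
  | cons a b iha ihb => exact iha.cons ihb

/-- Runs `P` once for each element of a list: the state `(l, (a, s))` consists of the remaining
list, a parameter and the accumulated value, and `P` turns `(a, (s, b))` into the new value. -/
def foldProg (P : Prog) : Prog :=
  .loop .head (.cons (.seq .head .tail) (.cons (.seq .tail .head)
    (.seq (.cons (.seq .tail .head) (.cons (.seq .tail .tail) (.seq .head .head))) P)))

theorem det_foldProg {P : Prog} {step : α × σ × β → σ} {a : α} {T : ℕ} (l : List β) (s : σ)
    (h : ∀ l' b, l' ++ [b] <+: l →
      Det P (enc (a, l'.foldl (fun s b => step (a, s, b)) s, b))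
        (enc (step (a, l'.foldl (fun s b => step (a, s, b)) s, b))) T) :
    Det (foldProg P) (enc (l, a, s)) (enc (([] : List β), a, l.foldl (fun s b => step (a, s, b)) s))
      (l.length * (T + 30) + 3) := by
  induction l generalizing s with
  | nil => exact .loop (.mono (.ite_false (Det.head _) (Det.ident _)) (by omega))
  | cons b l ih =>
    have h1 := h [] b (by simp)
    have h2 := ih (step (a, s, b)) (by
      intro l' b' hp
      simpa using h (b :: l') b' (by simpa using hp))
    have hb := Det.cons ((Det.head (enc (b :: l, a, s))).seq (Det.tail _))
      (.cons ((Det.tail (enc (b :: l, a, s))).seq (Det.head _))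
        (.seq (.cons ((Det.tail (enc (b :: l, a, s))).seq (Det.head _))
          (.cons ((Det.tail (enc (b :: l, a, s))).seq (Det.tail _))
            ((Det.head (enc (b :: l, a, s))).seq (Det.head _)))) h1))
    refine .loop (.mono (.ite_true (Det.head _) (by simp [Data.head]) (.seq hb h2)) ?_)
    simp only [List.length_cons, Nat.add_mul]; omega

/-! ### Polynomial time functions -/

/-- `PT f`: some deterministic program computes `f` in time polynomial in the size of the input,
and the output is of polynomial size. (The latter is not implied by the former, as cells can be
shared.) -/
def PT (f : α → β) : Prop :=
  ∃ (P : Prog) (t : α → ℕ), PB t ∧ (∀ a, Det P (enc a) (enc (f a)) (t a)) ∧ PB fun a => sz (f a)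

namespace PT

theorem size {f : α → β} (h : PT f) : PB fun a => sz (f a) := let ⟨_, _, _, _, h⟩ := h; h

theorem cast_out {f : α → β} {g : α → δ} (hf : PT f) (h : ∀ a, enc (g a) = enc (f a)) : PT g := by
  obtain ⟨P, t, ht, hP, hs⟩ := hf
  exact ⟨P, t, ht, fun a => h a ▸ hP a, hs.mono fun a => by rw [sz_def, h, sz_def]⟩

theorem id : PT (fun a : α => a) := ⟨.ident, fun _ => 1, .const 1, fun _ => Det.ident _, .size⟩

theorem const (b : β) : PT (fun _ : α => b) :=
  ⟨constProg (enc b), fun _ => (enc b).size, .const _, fun _ => det_constProg _ _, .const _⟩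

theorem fst : PT (fun a : α × β => a.1) :=
  ⟨.head, fun _ => 1, .const 1, fun _ => Det.head _, PB.size.mono fun a => by
    obtain ⟨a, b⟩ := a; simp only [sz_pair]; omega⟩

theorem snd : PT (fun a : α × β => a.2) :=
  ⟨.tail, fun _ => 1, .const 1, fun _ => Det.tail _, PB.size.mono fun a => by
    obtain ⟨a, b⟩ := a; simp only [sz_pair]; omega⟩

theorem comp {g : β → γ} {f : α → β} (hg : PT g) (hf : PT f) : PT (fun a => g (f a)) := by
  obtain ⟨P, t, ht, hP, hs⟩ := hf
  obtain ⟨Q, u, hu, hQ, hs'⟩ := hg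
  exact ⟨.seq P Q, fun a => t a + u (f a) + 1, (ht.add (hu.comp hs)).add (.const 1),
    fun a => (hP a).seq (hQ _), hs'.comp hs⟩

theorem pair {f : α → β} {g : α → γ} (hf : PT f) (hg : PT g) : PT (fun a => (f a, g a)) := by
  obtain ⟨P, t, ht, hP, hs⟩ := hf
  obtain ⟨Q, u, hu, hQ, hs'⟩ := hg
  exact ⟨.cons P Q, fun a => t a + u a + 1, (ht.add hu).add (.const 1),
    fun a => (hP a).cons (hQ _), (hs.add hs').add (.const 1)⟩

theorem fst' {f : α → β × γ} (hf : PT f) : PT (fun a => (f a).1) := fst.comp hf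
theorem snd' {f : α → β × γ} (hf : PT f) : PT (fun a => (f a).2) := snd.comp hf

theorem cons {f : α → β} {g : α → List β} (hf : PT f) (hg : PT g) : PT (fun a => f a :: g a) :=
  (hf.pair hg).cast_out fun _ => rfl

theorem succ {f : α → ℕ} (hf : PT f) : PT (fun a => f a + 1) :=
  ((const Data.nil).pair hf).cast_out fun _ => rfl

theorem tail {f : α → List β} (hf : PT f) : PT (fun a => (f a).tail) := by
  have : PT (fun l : List β => l.tail) :=
    ⟨.tail, fun _ => 1, .const 1, fun l => by cases l <;> exact Det.tail _,
      PB.size.mono fun l => sz_le_of_sublist (List.tail_sublist l)⟩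
  exact this.comp hf

theorem pred {f : α → ℕ} (hf : PT f) : PT (fun a => f a - 1) := by
  have : PT (fun n : ℕ => n - 1) :=
    ⟨.tail, fun _ => 1, .const 1, fun l => by cases l <;> exact Det.tail _,
      PB.size.mono fun l => by simp⟩
  exact this.comp hf

theorem cond {c : α → Bool} {f g : α → β} (hc : PT c) (hf : PT f) (hg : PT g) :
    PT (fun a => if c a then f a else g a) := by
  obtain ⟨R, v, hv, hR, -⟩ := hc
  obtain ⟨P, t, ht, hP, hs⟩ := hf
  obtain ⟨Q, u, hu, hQ, hs'⟩ := hg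
  refine ⟨.ite R P Q, fun a => v a + (t a + u a) + 1, (hv.add (ht.add hu)).add (.const 1),
    fun a => ?_, (hs.add hs').mono fun a => ?_⟩
  · have h := hR a
    cases hca : c a
    · rw [hca] at h
      simpa [hca] using (h.ite_false (p := P) (hQ a)).mono (u := v a + (t a + u a) + 1) (by omega)
    · rw [hca] at h
      simpa [hca] using (h.ite_true (q := Q) (by simp) (hP a)).mono (u := v a + (t a + u a) + 1)
        (by omega)
  · beta_reduce; split <;> omega

theorem isEmpty {f : α → List β} (hf : PT f) : PT (fun a => (f a).isEmpty) := by
  have : PT (fun l : List β => l.isEmpty) := by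
    refine ⟨.ite .ident (constProg (enc false)) (constProg (enc true)), fun _ => 5, .const 5,
      fun l => ?_, (PB.const 3).mono fun l => sz_bool _⟩
    cases l with
    | nil => exact (Det.ite_false (Det.ident _) (det_constProg (enc true) _)).mono le_rfl
    | cons b l =>
      exact (Det.ite_true (Det.ident _) (by simp) (det_constProg (enc false) _)).mono (by
        simp [Data.size])
  exact this.comp hf

theorem not {c : α → Bool} (hc : PT c) : PT (fun a => !c a) :=
  (hc.cond (const false) (const true)).cast_out fun a => by cases c a <;> rfl

theorem and {c d : α → Bool} (hc : PT c) (hd : PT d) : PT (fun a => c a && d a) :=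
  (hc.cond hd (const false)).cast_out fun a => by cases c a <;> simp

theorem xor {c d : α → Bool} (hc : PT c) (hd : PT d) : PT (fun a => c a ^^ d a) :=
  (hc.cond hd.not hd).cast_out fun a => by cases c a <;> simp

/-- Bounded iteration: the intermediate values have to be of polynomial size. -/
theorem foldl {l : α → List β} {s : α → σ} {step : α × σ × β → σ} (hl : PT l) (hs : PT s)
    (hstep : PT step) {B : α → ℕ} (hB : PB B)
    (h : ∀ a l', l' <+: l a → sz (l'.foldl (fun s b => step (a, s, b)) (s a)) ≤ B a) :
    PT (fun a => (l a).foldl (fun s b => step (a, s, b)) (s a)) := by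
  have hpre : PT (fun a => (l a, a, s a)) := hl.pair (id.pair hs)
  obtain ⟨P, t, ht, hP, hsz⟩ := hpre
  obtain ⟨Q, u, ⟨c, hc⟩, hQ, -⟩ := hstep
  have hN : PB (fun a => (sz a + B a + sz (l a) + 2 + 1) ^ c) :=
    ((((PB.size.add hB).add hl.size).add (.const 2)).add (.const 1)).pow c
  refine ⟨.seq P (.seq (foldProg Q) (.seq .tail .tail)),
    fun a => t a + (sz (l a) * ((sz a + B a + sz (l a) + 2 + 1) ^ c + 30) + 3 + 3 + 1) + 1, ?_,
    fun a => (hP a).seq (.seq (.mono (det_foldProg (l a) (s a)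
      (T := (sz a + B a + sz (l a) + 2 + 1) ^ c) ?_) ?_) (.seq (Det.tail _) (Det.tail _))),
    hB.mono fun a => h a _ (List.prefix_refl _)⟩
  · exact (ht.add ((((hl.size.mul (hN.add (.const 30))).add (.const 3)).add (.const 3)).add
      (.const 1))).add (.const 1)
  · intro l' b hlb
    refine (hQ _).mono ((hc _).trans (Nat.pow_le_pow_left ?_ c))
    have h1 := h a l' ((List.prefix_append _ _).trans hlb)
    have h2 : sz b ≤ sz (l a) := sz_le_of_mem (hlb.subset (by simp))
    simp only [sz_pair]; omega
  · gcongr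
    exact length_le_sz _

theorem foldl_cons_eq {ι : Type} (l s : List ι) : l.foldl (fun s b => b :: s) s = l.reverse ++ s := by
  induction l generalizing s with
  | nil => rfl
  | cons b l ih => simp [ih]

theorem reverse {f : α → List β} (hf : PT f) : PT (fun a => (f a).reverse) := by
  have : PT (fun l : List β => l.foldl (fun s b => b :: s) []) :=
    foldl (step := fun p => p.2.2 :: p.2.1) id (const []) (snd.snd'.cons snd.fst') .size (by
      intro l l' h
      simp only [foldl_cons_eq, List.append_nil, sz_reverse]
      exact sz_le_of_sublist h.sublist)
  exact (this.comp hf).cast_out fun a => by rw [foldl_cons_eq, List.append_nil]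

theorem map {l : α → List β} {f : α × β → γ} (hl : PT l) (hf : PT f) :
    PT (fun a => (l a).map fun b => f (a, b)) := by
  obtain ⟨c, hc⟩ := hf.size
  have key : ∀ (a : α) (l' : List β) (s : List γ),
      l'.foldl (fun s b => f (a, b) :: s) s = (l'.map fun b => f (a, b)).reverse ++ s := by
    intro a l'
    induction l' with
    | nil => simp
    | cons b l' ih => intro s; simp [ih]
  have : PT (fun a => (l a).foldl (fun s b => f (a, b) :: s) []) :=
    foldl (step := fun p => f (p.1, p.2.2) :: p.2.1) hl (const [])
      ((hf.comp (fst.pair snd.snd')).cons snd.fst')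
      (B := fun a => sz (l a) * ((sz a + sz (l a) + 1 + 1) ^ c + 1) + 1)
      ((hl.size.mul ((((PB.size.add hl.size).add (.const 1)).add (.const 1) |>.pow c).add
        (.const 1))).add (.const 1)) (by
      intro a l' h
      rw [key, List.append_nil, sz_reverse]
      refine (sz_le_of_forall (B := (sz a + sz (l a) + 1 + 1) ^ c) ?_).trans ?_
      · intro x hx
        obtain ⟨b, hb, rfl⟩ := List.mem_map.1 hx
        refine (hc _).trans (Nat.pow_le_pow_left ?_ _)
        have := sz_le_of_mem (h.subset hb)
        simp only [sz_pair]; omega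
      · gcongr
        simpa using h.length_le.trans (length_le_sz _))
  refine this.reverse.cast_out fun a => by rw [key]; simp

theorem append {f g : α → List β} (hf : PT f) (hg : PT g) : PT (fun a => f a ++ g a) := by
  have h1 : PT (fun p : List β × List β => p.1.foldl (fun s b => b :: s) p.2) :=
    foldl (step := fun p : (List β × List β) × List β × β => p.2.2 :: p.2.1) fst snd
      (snd.snd'.cons snd.fst') .size (by
      rintro ⟨l, m⟩ l' h
      simp only [foldl_cons_eq]
      have := sz_append l'.reverse m
      have h2 := sz_le_of_sublist h.sublist
      rw [sz_reverse] at this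
      simp only [sz_pair]; simp only [] at h2; omega)
  exact (h1.comp (hf.reverse.pair hg)).cast_out fun a => by simp

theorem flatten {f : α → List (List β)} (hf : PT f) : PT (fun a => (f a).flatten) := by
  have key : ∀ (l : List (List β)) (s : List β), l.foldl (fun s b => s ++ b) s = s ++ l.flatten := by
    intro l
    induction l with
    | nil => simp
    | cons b l ih => intro s; simp [ih]
  have hsz : ∀ (l : List (List β)), sz l.flatten ≤ sz l := by
    intro l
    induction l with
    | nil => simp
    | cons b l ih =>
      have := sz_append b l.flatten
      simp only [List.flatten_cons, sz_cons]; omega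
  have : PT (fun l : List (List β) => l.foldl (fun s b => s ++ b) []) :=
    foldl (step := fun p => p.2.1 ++ p.2.2) id (const []) (snd.fst'.append snd.snd') .size (by
      intro l l' h
      rw [key]
      exact (hsz _).trans (sz_le_of_sublist h.sublist))
  exact (this.comp hf).cast_out fun a => by rw [key]; simp

theorem flatMap {l : α → List β} {f : α × β → List γ} (hl : PT l) (hf : PT f) :
    PT (fun a => (l a).flatMap fun b => f (a, b)) :=
  (hl.map hf).flatten.cast_out fun a => by rw [List.flatMap_def]

theorem filter {l : α → List β} {f : α × β → Bool} (hl : PT l) (hf : PT f) :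
    PT (fun a => (l a).filter fun b => f (a, b)) := by
  refine (hl.flatMap (f := fun p => if f p then [p.2] else []) (hf.cond (snd.cons (const []))
    (const []))).cast_out fun a => ?_
  congr 1
  induction l a with
  | nil => rfl
  | cons b l ih => simp only [List.filter_cons, List.flatMap_cons, ← ih]; split <;> rfl

theorem any {l : α → List β} {f : α × β → Bool} (hl : PT l) (hf : PT f) :
    PT (fun a => (l a).any fun b => f (a, b)) :=
  (hl.filter hf).isEmpty.not.cast_out fun a => by
    congr 1
    rw [Bool.eq_iff_iff]
    simp

theorem product {l : α → List β} {m : α → List γ} (hl : PT l) (hm : PT m) :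
    PT (fun a => l a ×ˢ m a) :=
  (hl.flatMap (f := fun p => (m p.1).map fun c => (p.2, c))
    ((hm.comp fst).map (f := fun q : (α × β) × γ => (q.1.2, q.2)) (fst.snd'.pair snd))).cast_out
    fun _ => rfl

/-! ### Arithmetic in unary -/

/-- A natural number has the same representation as the list of that many empty trees. -/
theorem enc_replicate (n : ℕ) : enc (List.replicate n Data.nil) = enc n := by
  induction n with
  | zero => rfl
  | succ n ih => rw [List.replicate_succ, enc_cons, ih]; rfl

theorem replicate {f : α → ℕ} (hf : PT f) : PT (fun a => List.replicate (f a) Data.nil) :=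
  hf.cast_out fun _ => enc_replicate _

theorem length {f : α → List β} (hf : PT f) : PT (fun a => (f a).length) :=
  (hf.map (f := fun _ => Data.nil) (const Data.nil)).cast_out fun a => by
    rw [← enc_replicate]; simp [List.map_const']

theorem ofReplicate {f : α → List Data} {g : α → ℕ} (hf : PT f)
    (h : ∀ a, (f a).length = g a) : PT g :=
  hf.length.cast_out fun a => by rw [h]

theorem add {f g : α → ℕ} (hf : PT f) (hg : PT g) : PT (fun a => f a + g a) :=
  (hf.replicate.append hg.replicate).ofReplicate fun a => by simp

theorem mul {f g : α → ℕ} (hf : PT f) (hg : PT g) : PT (fun a => f a * g a) :=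
  (hf.replicate.flatMap (f := fun p => List.replicate (g p.1) Data.nil)
    (hg.comp fst).replicate).ofReplicate fun a => by simp

theorem sub {f g : α → ℕ} (hf : PT f) (hg : PT g) : PT (fun a => f a - g a) := by
  have key : ∀ (l : List Data) (s : ℕ), l.foldl (fun s _ => s - 1) s = s - l.length := by
    intro l
    induction l with
    | nil => simp
    | cons b l ih => intro s; simp [ih]; omega
  have : PT (fun a => (List.replicate (g a) Data.nil).foldl (fun s _ => s - 1) (f a)) :=
    foldl (step := fun p => p.2.1 - 1) hg.replicate hf snd.fst'.pred hf.size (by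
      intro a l' _
      rw [key]; simp)
  exact this.cast_out fun a => by rw [key]; simp

theorem le {f g : α → ℕ} (hf : PT f) (hg : PT g) : PT (fun a => decide (f a ≤ g a)) :=
  (hf.sub hg).replicate.isEmpty.cast_out fun a => by
    congr 1
    rw [Bool.eq_iff_iff]
    simp [Nat.sub_eq_zero_iff_le]

/-! ### Equality of trees -/

theorem data_head {f : α → Data} (hf : PT f) : PT (fun a => (f a).head) := by
  have : PT Data.head := ⟨.head, fun _ => 1, .const 1, fun l => Det.head _,
    PB.size.mono fun x => by cases x <;> simp [sz, Data.head, Data.size]; omega⟩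
  exact this.comp hf

theorem data_tail {f : α → Data} (hf : PT f) : PT (fun a => (f a).tail) := by
  have : PT Data.tail := ⟨.tail, fun _ => 1, .const 1, fun l => Det.tail _,
    PB.size.mono fun x => by cases x <;> simp [sz, Data.tail, Data.size]; omega⟩
  exact this.comp hf

theorem headD {f : α → List β} (hf : PT f) (b : β) : PT (fun a => (f a).headD b) := by
  have : PT (fun l : List β => l.headD b) := by
    refine ⟨.ite .ident .head (constProg (enc b)), fun _ => sz b + 3, .const _,
      fun l => ?_, (PB.size.add (.const (sz b))).mono fun l => ?_⟩
    · cases l with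
      | nil => exact (Det.ite_false (Det.ident _) (det_constProg (enc b) _)).mono (by
          simp only [sz]; omega)
      | cons c l =>
        exact (Det.ite_true (Det.ident (enc (c :: l))) (by simp) (Det.head _)).mono
          (u := sz b + 3) (by omega)
    · cases l with
      | nil => simp
      | cons c l => simp only [List.headD_cons, sz_cons]; omega
  exact this.comp hf

/-- Is the tree a single leaf? -/
def isNil : Data → Bool
  | .nil => true
  | .cons _ _ => false

theorem data_isNil {f : α → Data} (hf : PT f) : PT (fun a => isNil (f a)) := by
  have : PT isNil := by
    refine ⟨.ite .ident (constProg (enc false)) (constProg (enc true)), fun _ => 5, .const 5,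
      fun l => ?_, (PB.const 3).mono fun l => sz_bool _⟩
    cases l with
    | nil => exact (Det.ite_false (Det.ident _) (det_constProg (enc true) _)).mono le_rfl
    | cons b l =>
      exact (Det.ite_true (Det.ident _) (by simp) (det_constProg (enc false) _)).mono (by
        simp [Data.size])
  exact this.comp hf

/-- One step of the comparison of two trees: the list holds pairs of subtrees that are still to
be compared, the truth value tells that no difference has been found so far. -/
def eqStep (s : List (Data × Data) × Bool) : List (Data × Data) × Bool :=
  let p := s.1.headD (.nil, .nil)
  if isNil p.1 then (s.1.tail, if isNil p.2 then s.2 else false)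
  else if isNil p.2 then (s.1.tail, false)
  else ((p.1.head, p.2.head) :: (p.1.tail, p.2.tail) :: s.1.tail, s.2)

theorem eqStep_pt : PT eqStep := by
  have h : PT fun s : List (Data × Data) × Bool => s.1.headD (.nil, .nil) := fst.headD _
  exact (data_isNil h.fst').cond (fst.tail.pair ((data_isNil h.snd').cond snd (const false)))
    ((data_isNil h.snd').cond (fst.tail.pair (const false))
      (((data_head h.fst').pair (data_head h.snd')).cons
        (((data_tail h.fst').pair (data_tail h.snd')).cons fst.tail) |>.pair snd))

/-- The total size of the first components of the pending pairs drops with every step of the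
comparison, so the loop stops after that many rounds. -/
theorem det_eqLoop {P : Prog} {c : ℕ}
    (hP : ∀ s, Det P (enc s) (enc (eqStep s)) ((sz s + 1) ^ c)) (S : ℕ) :
    ∀ (m : ℕ) (l : List (Data × Data)) (b : Bool), (l.map fun p => p.1.size).sum ≤ m →
      sz (l, b) ≤ S → Det (.loop .head P) (enc (l, b))
        (enc (([] : List (Data × Data)), b && l.all fun p => p.1 == p.2))
        (m * ((S + 1) ^ c + 3) + 3) := by
  intro m
  induction m with
  | zero =>
    intro l b hl _
    cases l with
    | nil => exact .loop (.mono (.ite_false (Det.head _) (by simpa using Det.ident _)) (by omega))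
    | cons p l =>
      have := Data.size_pos p.1
      simp only [List.map_cons, List.sum_cons] at hl; omega
  | succ m ih =>
    intro l b hl hS
    cases l with
    | nil => exact .loop (.mono (.ite_false (Det.head _) (by simpa using Det.ident _)) (by omega))
    | cons p l =>
      have h1 := (hP (p :: l, b)).mono (Nat.pow_le_pow_left (Nat.add_le_add_right hS 1) c)
      obtain ⟨l', b', hs, hm, hz, he⟩ : ∃ l' b', eqStep (p :: l, b) = (l', b') ∧
          (l'.map fun p => p.1.size).sum ≤ m ∧ sz (l', b') ≤ sz (p :: l, b) ∧
          (b' && l'.all fun p => p.1 == p.2) = (b && (p :: l).all fun p => p.1 == p.2) := by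
        obtain ⟨x, y⟩ := p
        rcases x with _ | ⟨x₁, x₂⟩ <;> rcases y with _ | ⟨y₁, y₂⟩
        · refine ⟨l, b, rfl, ?_⟩
          simp [sz, Data.size] at hl ⊢; omega
        · refine ⟨l, false, rfl, ?_⟩
          cases b <;> simp [sz, Data.size] at hl ⊢ <;> omega
        · refine ⟨l, false, rfl, ?_⟩
          cases b <;> simp [sz, Data.size] at hl ⊢ <;> omega
        · refine ⟨(x₁, y₁) :: (x₂, y₂) :: l, b, rfl, ?_⟩
          refine ⟨?_, ?_, ?_⟩
          · simp [Data.size] at hl ⊢; omega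
          · simp [sz, Data.size]; omega
          · simp [Bool.beq_eq_decide_eq, Bool.and_assoc]
      rw [hs] at h1
      have h2 := ih l' b' hm (hz.trans hS)
      rw [he] at h2
      refine .loop (.mono (.ite_true (Det.head _) (by simp [Data.head]) (.seq h1 h2)) ?_)
      rw [Nat.add_mul]; omega

theorem beq_data : PT (fun p : Data × Data => p.1 == p.2) := by
  obtain ⟨P, t, ⟨c, hc⟩, hP, -⟩ := eqStep_pt
  have hpre : PT (fun p : Data × Data => ([p], true)) := (id.cons (const [])).pair (const true)
  obtain ⟨Q, u, hu, hQ, hs⟩ := hpre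
  refine ⟨.seq Q (.seq (.loop .head P) .tail),
    fun p => u p + (sz p * ((sz ([p], true) + 1) ^ c + 3) + 3 + 1 + 1) + 1, ?_, fun p => ?_,
    (PB.const 3).mono fun _ => sz_bool _⟩
  · exact (hu.add (((PB.size.mul (((hs.add (.const 1)).pow c).add (.const 3))).add
      (.const 3)).add (.const 1) |>.add (.const 1))).add (.const 1)
  · have := det_eqLoop (fun s => (hP s).mono (hc s)) (sz ([p], true)) (sz p) [p] true
      (by obtain ⟨a, b⟩ := p; simp [sz, Data.size]; omega) le_rfl
    simpa [Data.tail] using (hQ p).seq (this.seq (Det.tail _))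

theorem beq [DecidableEq β] {f g : α → β} (hf : PT f) (hg : PT g) :
    PT (fun a => decide (f a = g a)) := by
  have h : ∀ {f : α → β}, PT f → PT (fun a => enc (f a)) := fun h => h.cast_out fun _ => rfl
  exact (beq_data.comp ((h hf).pair (h hg))).cast_out fun a => by
    congr 1
    rw [Bool.eq_iff_iff]
    simp [inj.eq_iff]

theorem mem [DecidableEq β] {f : α → β} {l : α → List β} (hf : PT f) (hl : PT l) :
    PT (fun a => decide (f a ∈ l a)) :=
  (hl.any (f := fun p => decide (f p.1 = p.2)) ((hf.comp fst).beq snd)).cast_out fun a => by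
    congr 1
    rw [Bool.eq_iff_iff]
    simp

end PT

/-! ### Small bias implies large signed sums -/

/-- If every nonempty product of the signs has a small sum over the sample space `F`, then every
signed set `W` of at least `l` elements has a correlation of at least `l` with some sign vector.
The sign vectors that agree with `w` on `l` elements `X` of `W` cannot all have a negative
correlation with the rest of `W`. -/
theorem exists_large_signed_sum {V Ω : Type} [DecidableEq V] (F : Finset Ω) (s : Ω → V → ℤ)
    (hs : ∀ ω x, s ω x = 1 ∨ s ω x = -1) (W : Finset V) (w : V → ℤ)
    (hw : ∀ x, w x = 1 ∨ w x = -1) (l : ℕ) (hl : l ≤ W.card) (δ : ℤ) (hδ0 : 0 ≤ δ)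
    (hδ : ∀ T ⊆ W, T.Nonempty → |∑ ω ∈ F, ∏ x ∈ T, s ω x| ≤ δ)
    (h : 2 ^ l * (W.card + 1) * δ < F.card) :
    ∃ ω ∈ F, l ≤ ∑ x ∈ W, w x * s ω x := by
  classical
  obtain ⟨X, hXW, rfl⟩ := Finset.exists_subset_card_eq hl
  by_contra! hcon
  have hmul : ∀ a b : ℤ, (a = 1 ∨ a = -1) → (b = 1 ∨ b = -1) → (a * b = 1 ∨ a * b = -1) := by
    rintro a b (rfl | rfl) (rfl | rfl) <;> simp
  have hwT : ∀ T : Finset V, (∏ x ∈ T, w x) = 1 ∨ (∏ x ∈ T, w x) = -1 := by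
    intro T
    induction T using Finset.induction_on with
    | empty => simp
    | insert a T ha ih => rw [Finset.prod_insert ha]; exact hmul _ _ (hw a) ih
  -- the indicator of agreement with `w` on `X`, scaled by `2 ^ l`, times one plus the rest of the sum
  have hle : ∑ ω ∈ F, (∏ x ∈ X, (1 + w x * s ω x)) * (1 + ∑ y ∈ W \ X, w y * s ω y) ≤ 0 := by
    refine Finset.sum_nonpos fun ω hω => ?_
    by_cases hag : ∀ x ∈ X, w x * s ω x = 1
    · have h1 := hcon ω hω
      rw [← Finset.sum_sdiff hXW, Finset.sum_congr rfl hag] at h1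
      simp only [Finset.sum_const, nsmul_eq_mul, mul_one] at h1
      refine mul_nonpos_of_nonneg_of_nonpos (Finset.prod_nonneg fun x hx => ?_) (by linarith)
      rw [hag x hx]; norm_num
    · push Not at hag
      obtain ⟨x, hx, hne⟩ := hag
      rw [Finset.prod_eq_zero hx, zero_mul]
      rcases hmul _ _ (hw x) (hs ω x) with h1 | h1
      · exact absurd h1 hne
      · rw [h1]; norm_num
  have hterm : ∀ T ⊆ X, T.Nonempty → -δ ≤ ∑ ω ∈ F, ∏ x ∈ T, (w x * s ω x) := by
    intro T hT hne
    have h1 := hδ T (hT.trans hXW) hne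
    simp only [Finset.prod_mul_distrib, ← Finset.mul_sum]
    rw [abs_le] at h1
    rcases hwT T with h2 | h2 <;> rw [h2] <;> linarith
  have hterm' : ∀ T ⊆ X, ∀ y ∈ W \ X, -δ ≤ ∑ ω ∈ F, (∏ x ∈ T, (w x * s ω x)) * (w y * s ω y) := by
    intro T hT y hy
    rw [Finset.mem_sdiff] at hy
    have hyT : y ∉ T := fun h => hy.2 (hT h)
    have h1 := hδ (insert y T) (Finset.insert_subset hy.1 (hT.trans hXW)) (by simp)
    have h3 := hwT (insert y T)
    rw [abs_le] at h1
    have h2 : ∑ ω ∈ F, (∏ x ∈ T, (w x * s ω x)) * (w y * s ω y) =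
        (∏ x ∈ insert y T, w x) * ∑ ω ∈ F, ∏ x ∈ insert y T, s ω x := by
      rw [Finset.mul_sum]
      refine Finset.sum_congr rfl fun ω _ => ?_
      rw [Finset.prod_insert hyT, Finset.prod_insert hyT, Finset.prod_mul_distrib]; ring
    rw [h2]
    rcases h3 with h3 | h3 <;> rw [h3] <;> linarith
  have hexp : ∑ ω ∈ F, (∏ x ∈ X, (1 + w x * s ω x)) * (1 + ∑ y ∈ W \ X, w y * s ω y) =
      ∑ T ∈ X.powerset, (∑ ω ∈ F, ∏ x ∈ T, (w x * s ω x) +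
        ∑ y ∈ W \ X, ∑ ω ∈ F, (∏ x ∈ T, (w x * s ω x)) * (w y * s ω y)) := by
    simp only [Finset.prod_one_add, mul_add, mul_one, Finset.sum_mul, Finset.mul_sum,
      Finset.sum_add_distrib]
    congr 1
    · rw [Finset.sum_comm]
    · rw [Finset.sum_congr rfl fun ω _ => Finset.sum_comm, Finset.sum_comm]
      exact Finset.sum_congr rfl fun T _ => Finset.sum_comm
  rw [hexp, ← Finset.insert_erase (Finset.empty_mem_powerset X),
    Finset.sum_insert (Finset.notMem_erase _ _)] at hle
  have hc : ((W \ X).card : ℤ) + X.card = W.card := by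
    exact_mod_cast Finset.card_sdiff_add_card_eq_card hXW
  have h0 : (F.card : ℤ) + -((W \ X).card * δ) ≤ ∑ ω ∈ F, ∏ x ∈ (∅ : Finset V), (w x * s ω x) +
        ∑ y ∈ W \ X, ∑ ω ∈ F, (∏ x ∈ (∅ : Finset V), (w x * s ω x)) * (w y * s ω y) := by
    have := Finset.sum_le_sum (hterm' ∅ (by simp))
    simp only [Finset.sum_const, nsmul_eq_mul] at this
    simp only [Finset.prod_empty, Finset.sum_const, nsmul_eq_mul, mul_one] at this ⊢
    linarith
  have h1 : ((X.powerset.erase ∅).card : ℤ) * -(((W \ X).card + 1) * δ) ≤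
      ∑ T ∈ X.powerset.erase ∅, (∑ ω ∈ F, ∏ x ∈ T, (w x * s ω x) +
        ∑ y ∈ W \ X, ∑ ω ∈ F, (∏ x ∈ T, (w x * s ω x)) * (w y * s ω y)) := by
    rw [← nsmul_eq_mul, ← Finset.sum_const]
    refine Finset.sum_le_sum fun T hT => ?_
    rw [Finset.mem_erase, Finset.mem_powerset] at hT
    have h2 := hterm T hT.2 (Finset.nonempty_iff_ne_empty.2 hT.1)
    have h3 := Finset.sum_le_sum (hterm' T hT.2)
    simp only [Finset.sum_const, nsmul_eq_mul] at h3
    linarith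
  have h2 : ((X.powerset.erase ∅).card : ℤ) + 1 = 2 ^ X.card := by
    have := Finset.card_erase_add_one (Finset.empty_mem_powerset X)
    rw [Finset.card_powerset] at this
    exact_mod_cast this
  have h5 : ((W \ X).card : ℤ) ≤ W.card := by linarith [(Nat.cast_nonneg X.card : (0:ℤ) ≤ _)]
  set A : ℤ := ((X.powerset.erase ∅).card : ℤ)
  have h6 : (0:ℤ) ≤ A := by positivity
  have h7 : (A + 1) * ((W \ X).card + 1) * δ ≤ (2:ℤ) ^ X.card * (W.card + 1) * δ := by
    rw [← h2]; gcongr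
  linarith

/-! ### Arithmetic of bit vectors modulo `z ^ M - 1` -/

/-- Sum of two bit vectors. -/
def xorList (v w : List Bool) : List Bool := (v.zip w).map fun p => p.1 ^^ p.2

/-- Inner product of two bit vectors over the field with two elements. -/
def dot (v w : List Bool) : Bool := (v.zip w).foldl (fun s p => s ^^ (p.1 && p.2)) false

/-- Cyclic shift by one position. -/
def rot (v : List Bool) : List Bool := v.tail ++ [v.headD false]

/-- The sum of the shifts of `w` selected by the bits of `a`: the `j`-th bit of `a` stands for
`j` cyclic shifts. -/
def cmul (a w : List Bool) : List Bool :=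
  a.foldr (fun b s => if b then xorList w (rot s) else rot s) (w.map fun _ => false)

/-- The value at `ξ` of the polynomial whose coefficients are given by a bit vector. -/
def ev {K : Type} [Field K] (ξ : K) (v : List Bool) : K :=
  v.foldr (fun b s => (if b then 1 else 0) + ξ * s) 0

/-- The sign `(-1) ^ b`. -/
def sgn (b : Bool) : ℤ := if b then -1 else 1

theorem sgn_xor (a b : Bool) : sgn (a ^^ b) = sgn a * sgn b := by cases a <;> cases b <;> rfl

@[simp] theorem xorList_cons (a b : Bool) (v w : List Bool) :
    xorList (a :: v) (b :: w) = (a ^^ b) :: xorList v w := rfl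

theorem length_xorList {v w : List Bool} (h : v.length = w.length) :
    (xorList v w).length = v.length := by simp [xorList, h]

@[simp] theorem dot_nil (v : List Bool) : dot v [] = false := by simp [dot]

@[simp] theorem dot_cons (a b : Bool) (v w : List Bool) :
    dot (a :: v) (b :: w) = ((a && b) ^^ dot v w) := by
  have key : ∀ (l : List (Bool × Bool)) (s : Bool),
      l.foldl (fun s p => s ^^ (p.1 && p.2)) s =
        (s ^^ l.foldl (fun s p => s ^^ (p.1 && p.2)) false) := by
    intro l
    induction l with
    | nil => simp
    | cons p l ih =>
      intro s
      rw [List.foldl_cons, List.foldl_cons, ih, ih (false ^^ _)]; simp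
  simp only [dot, List.zip_cons_cons, List.foldl_cons]
  rw [key]; simp

theorem dot_xorList (y : List Bool) : ∀ v w : List Bool, v.length = y.length → w.length = y.length →
    dot y (xorList v w) = (dot y v ^^ dot y w) := by
  induction y with
  | nil => intro v w; simp +contextual [dot]
  | cons b y ih =>
    intro v w hv hw
    cases v with
    | nil => simp at hv
    | cons c v =>
      cases w with
      | nil => simp at hw
      | cons d w =>
        rw [xorList_cons, dot_cons, dot_cons, dot_cons, ih v w (by simpa using hv) (by simpa using hw)]
        cases b <;> cases c <;> cases d <;> simp

theorem length_rot {v : List Bool} (h : v ≠ []) : (rot v).length = v.length := by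
  cases v <;> simp [rot] at h ⊢

theorem length_cmul (a : List Bool) {w : List Bool} (h : w ≠ []) :
    (cmul a w).length = w.length := by
  induction a with
  | nil => simp [cmul]
  | cons b a ih =>
    have h1 : cmul a w ≠ [] := by
      rw [← List.length_pos_iff, ih, List.length_pos_iff]; exact h
    have h2 : (rot (cmul a w)).length = w.length := (length_rot h1).trans ih
    change (if b then xorList w (rot (cmul a w)) else rot (cmul a w)).length = _
    split
    · rw [length_xorList h2.symm]
    · exact h2

section Ev
variable {K : Type} [Field K]

@[simp] theorem ev_cons (ξ : K) (b : Bool) (v : List Bool) :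
    ev ξ (b :: v) = (if b then 1 else 0) + ξ * ev ξ v := rfl

theorem ev_append (ξ : K) (v w : List Bool) :
    ev ξ (v ++ w) = ev ξ v + ξ ^ v.length * ev ξ w := by
  induction v with
  | nil => simp [ev]
  | cons b v ih => simp only [List.cons_append, ev_cons, ih, List.length_cons]; ring

theorem ev_eq_zero_of_forall (ξ : K) {v : List Bool} (h : ∀ b ∈ v, b = false) : ev ξ v = 0 := by
  induction v with
  | nil => rfl
  | cons b v ih =>
    rw [ev_cons, ih fun b hb => h b (List.mem_cons_of_mem _ hb), h b List.mem_cons_self]; simp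

theorem ev_xorList [CharP K 2] (ξ : K) : ∀ v w : List Bool, v.length = w.length →
    ev ξ (xorList v w) = ev ξ v + ev ξ w := by
  intro v
  induction v with
  | nil => intro w h; cases w <;> simp at h ⊢; simp [ev, xorList]
  | cons b v ih =>
    intro w h
    cases w with
    | nil => simp at h
    | cons c w =>
      rw [xorList_cons, ev_cons, ev_cons, ev_cons, ih w (by simpa using h)]
      have : (2 : K) = 0 := CharTwo.two_eq_zero
      cases b <;> cases c <;> simp <;> first | ring1 | linear_combination -this

theorem ev_rot {ξ : K} {v : List Bool} (h : v ≠ []) (hξ : ξ ^ v.length = 1) :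
    ev ξ (rot v) = ξ⁻¹ * ev ξ v := by
  have h0 : ξ ≠ 0 := by
    rintro rfl
    rw [zero_pow (by simpa using h)] at hξ; simp at hξ
  cases v with
  | nil => simp at h
  | cons b v =>
    simp only [rot, List.tail_cons, List.headD_cons, ev_append, ev_cons]
    simp only [List.length_cons, pow_succ] at hξ
    have : ξ ^ v.length = ξ⁻¹ := eq_inv_of_mul_eq_one_left hξ
    rw [this]; field_simp; simp [ev]; ring

/-- Evaluation turns `cmul` into multiplication. As `rot` divides by `z`, the bits of the first factor
are evaluated at the inverse of `ξ`. -/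
theorem ev_cmul [CharP K 2] {ξ : K} (a : List Bool) {w : List Bool} (h : w ≠ [])
    (hξ : ξ ^ w.length = 1) : ev ξ (cmul a w) = ev ξ⁻¹ a * ev ξ w := by
  induction a with
  | nil =>
    rw [ev_eq_zero_of_forall]
    · simp [ev]
    · simp [cmul]
  | cons b a ih =>
    have hl := length_cmul a h
    have h1 : cmul a w ≠ [] := by
      rw [← List.length_pos_iff, hl, List.length_pos_iff]; exact h
    have h2 : (rot (cmul a w)).length = w.length := (length_rot h1).trans hl
    change ev ξ (if b then xorList w (rot (cmul a w)) else rot (cmul a w)) = _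
    have h3 : ev ξ (rot (cmul a w)) = ξ⁻¹ * (ev ξ⁻¹ a * ev ξ w) := by
      rw [ev_rot h1 (by rw [hl]; exact hξ), ih]
    cases b
    · simp [h3]; ring
    · simp [ev_xorList ξ _ _ h2.symm, h3]; ring

end Ev

/-- All bit vectors of length `n`. -/
def allBits : ℕ → List (List Bool)
  | 0 => [[]]
  | n + 1 => (allBits n).map (false :: ·) ++ (allBits n).map (true :: ·)

theorem mem_allBits {n : ℕ} {v : List Bool} : v ∈ allBits n ↔ v.length = n := by
  induction n generalizing v with
  | zero => simp [allBits]
  | succ n ih =>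
    cases v with
    | nil => simp [allBits]
    | cons b v => cases b <;> simp [allBits, ih]

theorem nodup_allBits (n : ℕ) : (allBits n).Nodup := by
  induction n with
  | zero => simp [allBits]
  | succ n ih =>
    rw [allBits, List.nodup_append]
    refine ⟨ih.map fun _ _ h => by simpa using h, ih.map fun _ _ h => by simpa using h, ?_⟩
    simp

theorem length_allBits (n : ℕ) : (allBits n).length = 2 ^ n := by
  induction n with
  | zero => rfl
  | succ n ih => simp [allBits, ih, pow_succ]; ring

/-- Orthogonality: a nontrivial character of the bit vectors has sum zero. -/
theorem sum_sgn_dot (v : List Bool) (h : ∃ b ∈ v, b = true) :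
    ((allBits v.length).map fun y => sgn (dot y v)).sum = 0 := by
  induction v with
  | nil => simp at h
  | cons b v ih =>
    have h1 : ∀ (c : Bool), (fun y => sgn (dot y (b :: v))) ∘ (c :: ·) =
        fun y => sgn (c && b) * sgn (dot y v) := by
      intro c; funext y; simp [sgn_xor]
    simp only [List.length_cons, allBits, List.map_append, List.map_map, List.sum_append, h1,
      List.sum_map_mul_left]
    cases b
    · rw [ih (by simpa using h)]; simp
    · simp [sgn]

/-! ### A field whose elements are represented by short bit vectors -/

/-- The order of `2` modulo `3 ^ (k + 1)` is at least `2 * 3 ^ k`. -/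
theorem two_mul_three_pow_le {k e : ℕ} (he : e ≠ 0) (h : 3 ^ (k + 1) ∣ 2 ^ e - 1) :
    2 * 3 ^ k ≤ e := by
  have h3 : 3 ∣ 2 ^ e - 1 := (dvd_pow_self 3 (by omega)).trans h
  have hodd : Even e := by
    by_contra hne
    obtain ⟨m, rfl⟩ := Nat.not_even_iff_odd.1 hne
    have h4 : 4 ^ m % 3 = 1 := by rw [Nat.pow_mod]; simp
    have : 2 ^ (2 * m + 1) = 2 * 4 ^ m := by rw [pow_succ, pow_mul]; ring
    rw [this] at h3
    omega
  obtain ⟨m, rfl⟩ := hodd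
  have hm : m ≠ 0 := by omega
  have h4 : 2 ^ (m + m) - 1 = 4 ^ m - 1 ^ m := by
    rw [one_pow, ← two_mul, pow_mul]; norm_num
  have : Fact (Nat.Prime 3) := ⟨Nat.prime_three⟩
  have hval := padicValNat.pow_sub_pow (p := 3) (by decide) (show 1 < 4 by norm_num) (by norm_num)
    (by norm_num) hm
  have hne : 4 ^ m - 1 ^ m ≠ 0 := by
    have : 1 < 4 ^ m := Nat.one_lt_pow hm (by norm_num)
    simp; omega
  rw [h4, padicValNat_dvd_iff_le hne, hval] at h
  have h5 : padicValNat 3 (4 - 1) = 1 := by simp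
  have h6 : 3 ^ k ∣ m := (padicValNat_dvd_iff_le hm).2 (by omega)
  have := Nat.le_of_dvd (by omega) h6
  omega

open Polynomial in
/-- Adjoining a root of unity `ξ` of order `3 ^ (k + 1)` to the field with two elements gives an
extension of degree `2 * 3 ^ k`, since `2` is a primitive root modulo `3 ^ (k + 1)`. -/
theorem exists_field (k : ℕ) : ∃ (K : Type) (_ : Field K) (_ : CharP K 2) (ξ : K),
    ξ ^ 3 ^ (k + 1) = 1 ∧
      ∀ v : List Bool, v.length ≤ 2 * 3 ^ k → ev ξ⁻¹ v = 0 → ∀ b ∈ v, b = false := by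
  have hn : Nat.Coprime 2 (3 ^ (k + 1)) := Nat.Coprime.pow_right _ (by norm_num)
  obtain ⟨P, hirr, hdvd⟩ := Polynomial.exists_irreducible_of_degree_pos (f :=
    cyclotomic (3 ^ (k + 1)) (ZMod 2)) (by
      rw [degree_cyclotomic]; exact_mod_cast (Nat.totient_pos.2 (by positivity)))
  -- the degree of `P` is the order of `2` modulo `3 ^ (k + 1)`
  have hP := natDegree_of_dvd_cyclotomic_of_irreducible (f := 1) (by simp) hn hdvd hirr
  have hle : 2 * 3 ^ k ≤ P.natDegree := by
    refine two_mul_three_pow_le hirr.natDegree_pos.ne' ?_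
    have h1 := pow_orderOf_eq_one (ZMod.unitOfCoprime _ (hn.pow_left 1))
    rw [← hP] at h1
    have h2 := congrArg Units.val h1
    simp only [Units.val_pow_eq_pow_val, ZMod.coe_unitOfCoprime, Units.val_one] at h2
    have h3 : ((2 ^ P.natDegree : ℕ) : ZMod (3 ^ (k + 1))) = ((1 : ℕ) : ZMod (3 ^ (k + 1))) := by
      simpa using h2
    exact (Nat.modEq_iff_dvd' Nat.one_le_two_pow).1 ((ZMod.natCast_eq_natCast_iff _ _ _).1 h3).symm
  have : Fact (Irreducible P) := ⟨hirr⟩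
  have hchar : CharP (AdjoinRoot P) 2 := charP_of_injective_algebraMap
    (algebraMap (ZMod 2) (AdjoinRoot P)).injective 2
  refine ⟨AdjoinRoot P, inferInstance, hchar, (AdjoinRoot.root P)⁻¹, ?_, fun v hv hev => ?_⟩
  · have h1 : P ∣ X ^ 3 ^ (k + 1) - 1 := hdvd.trans (cyclotomic.dvd_X_pow_sub_one _ _)
    have h2 := AdjoinRoot.mk_eq_zero.2 h1
    simp only [map_sub, map_pow, AdjoinRoot.mk_X, map_one, sub_eq_zero] at h2
    rw [inv_pow, h2, inv_one]
  · rw [inv_inv] at hev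
    -- the polynomial with coefficients `v`
    have hpoly : ∀ v : List Bool, ∃ Q : (ZMod 2)[X], AdjoinRoot.mk P Q = ev (AdjoinRoot.root P) v ∧
        Q.degree < v.length ∧ (Q = 0 → ∀ b ∈ v, b = false) := by
      intro v
      induction v with
      | nil => exact ⟨0, by simp [ev]⟩
      | cons b v ih =>
        obtain ⟨Q, h1, h2, h3⟩ := ih
        refine ⟨C (if b then 1 else 0) + X * Q, ?_, ?_, fun h => ?_⟩
        · rw [ev_cons, map_add, map_mul, AdjoinRoot.mk_X, h1]
          cases b <;> simp
        · refine (degree_add_le _ _).trans_lt (max_lt ?_ ?_)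
          · refine degree_C_le.trans_lt ?_
            exact_mod_cast Nat.succ_pos _
          · rw [degree_mul, degree_X]
            rcases eq_or_ne Q 0 with rfl | hQ
            · simp
            · rw [degree_eq_natDegree hQ] at h2 ⊢
              have : Q.natDegree < v.length := by exact_mod_cast h2
              rw [List.length_cons]
              exact_mod_cast (by omega : 1 + Q.natDegree < v.length + 1)
        · have h0 := congrArg (fun p => coeff p 0) h
          simp only [coeff_add, coeff_C_zero, mul_coeff_zero, coeff_X_zero, zero_mul, add_zero,
            coeff_zero] at h0
          have hb : b = false := by cases b <;> simp at h0 ⊢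
          subst hb
          have hQ : Q = 0 := by simpa using h
          intro c hc
          rcases List.mem_cons.1 hc with rfl | hc
          · rfl
          · exact h3 hQ c hc
    obtain ⟨Q, h1, h2, h3⟩ := hpoly v
    refine h3 ?_
    by_contra hQ
    rw [hev, AdjoinRoot.mk_eq_zero] at h1
    have h4 := natDegree_le_of_dvd h1 hQ
    rw [degree_eq_natDegree hQ] at h2
    have : Q.natDegree < v.length := by exact_mod_cast h2
    omega

/-! ### The powering construction has small bias -/

theorem eq_of_xorList : ∀ v w : List Bool, v.length = w.length →
    (∀ b ∈ xorList v w, b = false) → v = w := by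
  intro v
  induction v with
  | nil => intro w h _; cases w <;> simp at h ⊢
  | cons b v ih =>
    intro w h hx
    cases w with
    | nil => simp at h
    | cons c w =>
      rw [xorList_cons] at hx
      rw [ih w (by simpa using h) fun d hd => hx d (List.mem_cons_of_mem _ hd)]
      have := hx _ List.mem_cons_self
      cases b <;> cases c <;> simp at this ⊢

/-- The bit vector representing `1` that has the length of the (nonempty) vector `a`. -/
def unitVec (a : List Bool) : List Bool := true :: a.tail.map fun _ => false

/-- The `i`-th power of the element represented by `a`. -/
def powVec (a : List Bool) (i : ℕ) : List Bool := (cmul a)^[i] (unitVec a)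

theorem length_powVec {a : List Bool} (h : a ≠ []) (i : ℕ) : (powVec a i).length = a.length := by
  induction i with
  | zero => cases a <;> simp [powVec, unitVec] at h ⊢
  | succ i ih =>
    have h1 : powVec a i ≠ [] := by
      rw [← List.length_pos_iff, ih, List.length_pos_iff]; exact h
    rw [powVec, Function.iterate_succ_apply']
    exact (length_cmul a h1).trans ih

theorem ev_powVec {K : Type} [Field K] [CharP K 2] {ξ : K} {a : List Bool} (h : a ≠ [])
    (hξ : ξ ^ a.length = 1) (i : ℕ) : ev ξ (powVec a i) = ev ξ⁻¹ a ^ i := by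
  induction i with
  | zero =>
    rw [powVec, Function.iterate_zero, id, unitVec, ev_cons, ev_eq_zero_of_forall ξ (by simp)]
    simp
  | succ i ih =>
    have hl := length_powVec h i
    have h1 : powVec a i ≠ [] := by
      rw [← List.length_pos_iff, hl, List.length_pos_iff]; exact h
    rw [powVec, Function.iterate_succ_apply']
    change ev ξ (cmul a (powVec a i)) = _
    rw [ev_cmul a h1 (by rw [hl]; exact hξ), ih, pow_succ']

/-- The character of a set of positions is the sign of the inner product with a single vector. -/
theorem exists_sum_powVec {K : Type} [Field K] [CharP K 2] {ξ : K} {a : List Bool} (h : a ≠ [])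
    (hξ : ξ ^ a.length = 1) (T : Finset ℕ) : ∃ v : List Bool, v.length = a.length ∧
      ev ξ v = ∑ i ∈ T, ev ξ⁻¹ a ^ i ∧
      ∀ y : List Bool, y.length = a.length →
        ∏ i ∈ T, sgn (dot y (powVec a i)) = sgn (dot y v) := by
  induction T using Finset.induction_on with
  | empty =>
    refine ⟨a.map fun _ => false, by simp, by rw [ev_eq_zero_of_forall]; simp; simp,
      fun y hy => ?_⟩
    have : ∀ y a : List Bool, dot y (a.map fun _ => false) = false := by
      intro y
      induction y with
      | nil => simp [dot]
      | cons b y ih =>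
        intro a
        cases a with
        | nil => simp [dot]
        | cons c a => rw [List.map_cons, dot_cons, ih]; simp
    rw [this]; rfl
  | insert i T hi ih =>
    obtain ⟨v, hl, he, hs⟩ := ih
    have hp := length_powVec h i
    refine ⟨xorList (powVec a i) v, ?_, ?_, fun y hy => ?_⟩
    · rw [length_xorList (hp.trans hl.symm), hp]
    · rw [ev_xorList _ _ _ (hp.trans hl.symm), ev_powVec h hξ, he, Finset.sum_insert hi]
    · rw [Finset.prod_insert hi, hs y hy, dot_xorList y _ _ (hp.trans hy.symm) (hl.trans hy.symm),
        sgn_xor]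

/-- The finite set of all bit vectors of length `n`. -/
def bitVecs (n : ℕ) : Finset (List Bool) := (allBits n).toFinset

theorem mem_bitVecs {n : ℕ} {v : List Bool} : v ∈ bitVecs n ↔ v.length = n := by
  rw [bitVecs, List.mem_toFinset, mem_allBits]

theorem card_bitVecs (n : ℕ) : (bitVecs n).card = 2 ^ n := by
  rw [bitVecs, List.toFinset_card_of_nodup (nodup_allBits n), length_allBits]

/-- A nonzero polynomial of degree less than `N` has at most `N` roots, and each of them is the value of
at most `2 ^ 3 ^ k` bit vectors: of two vectors with the same value that agree from position
`2 * 3 ^ k` on, the difference is a short vector of value zero. -/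
theorem card_root_le (k N : ℕ) {K : Type} [Field K] [CharP K 2] [DecidableEq K] {ξ : K}
    (hind : ∀ v : List Bool, v.length ≤ 2 * 3 ^ k → ev ξ⁻¹ v = 0 → ∀ b ∈ v, b = false)
    (T : Finset ℕ) (hT : T ⊆ Finset.range N) (hne : T.Nonempty) :
    ((bitVecs (3 ^ (k + 1))).filter fun a => ∑ i ∈ T, ev ξ⁻¹ a ^ i = 0).card ≤ 2 ^ 3 ^ k * N := by
  classical
  set p : Polynomial K := ∑ i ∈ T, Polynomial.X ^ i with hp
  have hcoeff : ∀ i ∈ T, p.coeff i = 1 := by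
    intro i hi
    simp [hp, Polynomial.coeff_X_pow, hi]
  have hp0 : p ≠ 0 := by
    obtain ⟨i, hi⟩ := hne
    intro h0
    have := hcoeff i hi
    rw [h0] at this; simp at this
  have hdeg : p.natDegree ≤ N := Polynomial.natDegree_sum_le_of_forall_le _ _ fun i hi => by
    rw [Polynomial.natDegree_X_pow]; exact (Finset.mem_range.1 (hT hi)).le
  have h3 : 3 ^ (k + 1) = 2 * 3 ^ k + 3 ^ k := by ring
  refine (Finset.card_le_mul_card_image_of_maps_to (f := fun a => ev ξ⁻¹ a) (t := p.roots.toFinset)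
    ?_ (2 ^ 3 ^ k) ?_).trans (Nat.mul_le_mul_left _
      ((Multiset.toFinset_card_le _).trans ((Polynomial.card_roots' p).trans hdeg)))
  · intro a ha
    rw [Multiset.mem_toFinset, Polynomial.mem_roots hp0, Polynomial.IsRoot, hp,
      Polynomial.eval_finsetSum]
    simpa using (Finset.mem_filter.1 ha).2
  · intro κ _
    rw [← card_bitVecs]
    refine Finset.card_le_card_of_injOn (fun a => a.drop (2 * 3 ^ k)) ?_ ?_
    · intro a ha
      simp only [Finset.coe_filter, Finset.mem_filter, Set.mem_ofPred_eq, mem_bitVecs] at ha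
      simp only [Finset.mem_coe, mem_bitVecs, List.length_drop]; omega
    · intro a ha b hb hab
      simp only [Finset.coe_filter, Finset.mem_filter, Set.mem_ofPred_eq, mem_bitVecs] at ha hb hab
      have hla : (a.take (2 * 3 ^ k)).length = 2 * 3 ^ k := by simp; omega
      have hlb : (b.take (2 * 3 ^ k)).length = 2 * 3 ^ k := by simp; omega
      have hl := hla.trans hlb.symm
      have h1 := ev_append ξ⁻¹ (a.take (2 * 3 ^ k)) (a.drop (2 * 3 ^ k))
      have h2 := ev_append ξ⁻¹ (b.take (2 * 3 ^ k)) (b.drop (2 * 3 ^ k))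
      rw [List.take_append_drop, ha.2, hla] at h1
      rw [List.take_append_drop, hb.2, hlb] at h2
      rw [hab] at h1
      have h4 : ev ξ⁻¹ (xorList (a.take (2 * 3 ^ k)) (b.take (2 * 3 ^ k))) = 0 := by
        rw [ev_xorList _ _ _ hl]
        have h5 : ev ξ⁻¹ (a.take (2 * 3 ^ k)) = ev ξ⁻¹ (b.take (2 * 3 ^ k)) :=
          add_right_cancel (h1.symm.trans h2)
        rw [h5, CharTwo.add_self_eq_zero]
      have h5 := eq_of_xorList _ _ hl
        (hind _ (by rw [length_xorList hl, hla]) h4)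
      rw [← List.take_append_drop (2 * 3 ^ k) a, ← List.take_append_drop (2 * 3 ^ k) b, h5, hab]

/-- The product of the signs over `T` averages to zero over `y` unless `a` is a root of the polynomial
`∑ i ∈ T, X ^ i`, and few `a` are roots. -/
theorem bias_le (k N : ℕ) (T : Finset ℕ) (hT : T ⊆ Finset.range N) (hne : T.Nonempty) :
    |∑ ω ∈ bitVecs (3 ^ (k + 1)) ×ˢ bitVecs (3 ^ (k + 1)),
      ∏ i ∈ T, sgn (dot ω.2 (powVec ω.1 i))| ≤ 2 ^ 3 ^ k * N * 2 ^ 3 ^ (k + 1) := by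
  classical
  obtain ⟨K, _, _, ξ, hξ, hind⟩ := exists_field k
  rw [Finset.sum_product]
  have hsgn : ∀ b, |sgn b| = 1 := by intro b; cases b <;> rfl
  have hrow : ∀ a ∈ bitVecs (3 ^ (k + 1)),
      |∑ y ∈ bitVecs (3 ^ (k + 1)), ∏ i ∈ T, sgn (dot y (powVec a i))| ≤
        if ∑ i ∈ T, ev ξ⁻¹ a ^ i = 0 then 2 ^ 3 ^ (k + 1) else 0 := by
    intro a ha
    rw [mem_bitVecs] at ha
    have ha0 : a ≠ [] := by
      rintro rfl
      have : 0 < 3 ^ (k + 1) := by positivity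
      rw [← ha] at this; simp at this
    split
    · refine (Finset.abs_sum_le_sum_abs _ _).trans ?_
      simp only [Finset.abs_prod, hsgn, Finset.prod_const_one, Finset.sum_const, card_bitVecs]
      simp
    · rename_i hne0
      obtain ⟨v, hl, he, hs⟩ := exists_sum_powVec ha0 (by rw [ha]; exact hξ) T
      rw [Finset.sum_congr rfl fun y hy => hs y ((mem_bitVecs.1 hy).trans ha.symm), bitVecs,
        List.sum_toFinset _ (nodup_allBits _), ← ha, ← hl, sum_sgn_dot]
      · simp
      · by_contra! hv
        exact hne0 (he ▸ ev_eq_zero_of_forall ξ fun b hb => by simpa using hv b hb)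
  refine (Finset.abs_sum_le_sum_abs _ _).trans ((Finset.sum_le_sum hrow).trans ?_)
  rw [← Finset.sum_filter, Finset.sum_const, nsmul_eq_mul]
  gcongr
  exact_mod_cast card_root_le k N hind T hT hne

/-- The powering construction as a sample space: its bias is small enough for sets of at most `N`
positions if `2 ^ (2 * 3 ^ k)` is large compared with `2 ^ l` and `N`. -/
theorem exists_sign_sum_ge (k l N : ℕ) (h : 2 ^ l * (N + 1) * N < 2 ^ (2 * 3 ^ k)) (W : Finset ℕ)
    (hW : W ⊆ Finset.range N) (hl : l ≤ W.card) (w : ℕ → ℤ) (hw : ∀ x, w x = 1 ∨ w x = -1) :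
    ∃ a ∈ bitVecs (3 ^ (k + 1)), ∃ y ∈ bitVecs (3 ^ (k + 1)),
      (l : ℤ) ≤ ∑ i ∈ W, w i * sgn (dot y (powVec a i)) := by
  obtain ⟨ω, hω, hsum⟩ := exists_large_signed_sum (bitVecs (3 ^ (k + 1)) ×ˢ bitVecs (3 ^ (k + 1)))
    (fun ω i => sgn (dot ω.2 (powVec ω.1 i))) (fun ω i => by
      cases dot ω.2 (powVec ω.1 i) <;> simp [sgn]) W w hw l hl
    (2 ^ 3 ^ k * N * 2 ^ 3 ^ (k + 1)) (by positivity)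
    (fun T hT hne => bias_le k N T (hT.trans hW) hne) (by
      have hWN : W.card ≤ N := by simpa using Finset.card_le_card hW
      rw [Finset.card_product, card_bitVecs]
      have h3 : 3 ^ (k + 1) = 2 * 3 ^ k + 3 ^ k := by ring
      have h4 : 2 ^ l * (W.card + 1) * (2 ^ 3 ^ k * N * 2 ^ 3 ^ (k + 1)) <
          2 ^ 3 ^ (k + 1) * 2 ^ 3 ^ (k + 1) := by
        calc 2 ^ l * (W.card + 1) * (2 ^ 3 ^ k * N * 2 ^ 3 ^ (k + 1))
            = (2 ^ l * (W.card + 1) * N) * (2 ^ 3 ^ k * 2 ^ 3 ^ (k + 1)) := by ring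
          _ ≤ (2 ^ l * (N + 1) * N) * (2 ^ 3 ^ k * 2 ^ 3 ^ (k + 1)) := by gcongr
          _ < 2 ^ (2 * 3 ^ k) * (2 ^ 3 ^ k * 2 ^ 3 ^ (k + 1)) := by gcongr
          _ = 2 ^ 3 ^ (k + 1) * 2 ^ 3 ^ (k + 1) := by
            rw [← mul_assoc, ← pow_add, ← h3]
      exact_mod_cast h4)
  rw [Finset.mem_product] at hω
  exact ⟨ω.1, hω.1, ω.2, hω.2, hsum⟩

/-! ### Bit vectors in polynomial time -/

theorem sz_bits_le (v : List Bool) : sz v ≤ v.length * 4 + 1 :=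
  sz_le_of_forall (B := 3) fun b _ => sz_bool b

namespace PT

theorem zip {f g : α → List Bool} (hf : PT f) (hg : PT g) : PT (fun a => (f a).zip (g a)) := by
  have key : ∀ (l m : List Bool) (acc : List (Bool × Bool)),
      l.foldl (fun s b => if s.1.isEmpty then s else (s.1.tail, (b, s.1.headD false) :: s.2))
        (m, acc) = (m.drop l.length, (l.zip m).reverse ++ acc) := by
    intro l
    induction l with
    | nil => simp
    | cons b l ih =>
      intro m acc
      cases m with
      | nil => simpa using ih [] acc
      | cons c m => exact (ih m ((b, c) :: acc)).trans (by simp)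
  have h : PT (fun p : List Bool × List Bool => p.1.foldl
      (fun s b => if s.1.isEmpty then s else (s.1.tail, (b, s.1.headD false) :: s.2)) (p.2, [])) := by
    have hs1 : PT (fun q : (List Bool × List Bool) × (List Bool × List (Bool × Bool)) × Bool =>
      q.2.1.1) := snd.fst'.fst'
    refine foldl (step := fun q : (List Bool × List Bool) × (List Bool × List (Bool × Bool)) × Bool =>
        if q.2.1.1.isEmpty then q.2.1 else
          (q.2.1.1.tail, (q.2.2, q.2.1.1.headD false) :: q.2.1.2))
      fst (snd.pair (const [])) (hs1.isEmpty.cond snd.fst' (hs1.tail.pair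
        ((snd.snd'.pair (hs1.headD false)).cons snd.fst'.snd')))
      (B := fun p => sz p.2 + (sz p.1 * 8 + 1) + 1)
      ((snd.size.add ((fst.size.mul (.const 8)).add (.const 1))).add (.const 1)) ?_
    intro p l' hl
    rw [key, sz_pair, List.append_nil, sz_reverse]
    have h1 := sz_le_of_sublist (List.drop_sublist l'.length p.2)
    have h2 : sz (l'.zip p.2) ≤ (l'.zip p.2).length * (7 + 1) + 1 :=
      sz_le_of_forall fun q _ => by
        obtain ⟨b, c⟩ := q
        have := sz_bool b; have := sz_bool c; simp only [sz_pair]; omega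
    have h3 : (l'.zip p.2).length ≤ sz p.1 := by
      rw [List.length_zip]
      exact (min_le_left _ _).trans (hl.length_le.trans (length_le_sz _))
    omega
  exact (h.comp (hf.pair hg)).snd'.reverse.cast_out fun a => by rw [key]; simp

theorem xorList {f g : α → List Bool} (hf : PT f) (hg : PT g) :
    PT (fun a => xorList (f a) (g a)) :=
  (hf.zip hg).map (f := fun p : α × (Bool × Bool) => p.2.1 ^^ p.2.2) (snd.fst'.xor snd.snd')

theorem dot {f g : α → List Bool} (hf : PT f) (hg : PT g) : PT (fun a => dot (f a) (g a)) :=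
  foldl (step := fun p : α × Bool × (Bool × Bool) => p.2.1 ^^ (p.2.2.1 && p.2.2.2))
    (hf.zip hg) (const false) (snd.fst'.xor (snd.snd'.fst'.and snd.snd'.snd')) (.const 3)
    fun _ _ _ => sz_bool _

theorem rot {f : α → List Bool} (hf : PT f) : PT (fun a => rot (f a)) :=
  hf.tail.append ((hf.headD false).cons (const []))

theorem length_cmul_le (a w : List Bool) : (DiverseMultistage.cmul a w).length ≤ w.length + 1 := by
  induction a with
  | nil => simp [DiverseMultistage.cmul]
  | cons b a ih =>
    have h : (DiverseMultistage.rot (DiverseMultistage.cmul a w)).length ≤ w.length + 1 := by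
      simp only [DiverseMultistage.rot, List.length_append, List.length_tail, List.length_singleton]
      omega
    change (if b then DiverseMultistage.xorList w _ else _ : List Bool).length ≤ _
    split
    · simp only [DiverseMultistage.xorList, List.length_map, List.length_zip]; omega
    · exact h

theorem cmul {f g : α → List Bool} (hf : PT f) (hg : PT g) : PT (fun a => cmul (f a) (g a)) := by
  have h : PT (fun p : List Bool × List Bool => p.1.reverse.foldl
      (fun s b => if b then DiverseMultistage.xorList p.2 (DiverseMultistage.rot s)
        else DiverseMultistage.rot s) (p.2.map fun _ => false)) := by
    refine foldl (step := fun q : (List Bool × List Bool) × List Bool × Bool =>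
      if q.2.2 then DiverseMultistage.xorList q.1.2 (DiverseMultistage.rot q.2.1)
        else DiverseMultistage.rot q.2.1) fst.reverse
      (snd.map (f := fun _ => false) (const false))
      (snd.snd'.cond (fst.snd'.xorList snd.fst'.rot) snd.fst'.rot)
      (B := fun p => (sz p.2 + 1) * 4 + 1)
      (((snd.size.add (.const 1)).mul (.const 4)).add (.const 1)) ?_
    intro p l' _
    refine (sz_bits_le _).trans ?_
    have h1 := length_cmul_le l'.reverse p.2
    rw [DiverseMultistage.cmul, List.foldr_reverse] at h1
    have h2 := length_le_sz p.2
    gcongr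
    exact h1.trans (by omega)
  exact (h.comp (hf.pair hg)).cast_out fun a => by
    rw [List.foldl_reverse]; rfl

theorem unitVec {f : α → List Bool} (hf : PT f) : PT (fun a => unitVec (f a)) :=
  (const true).cons (hf.tail.map (f := fun _ => false) (const false))

end PT

/-- The elements of `U` whose position `i` has inner product `1` between `y` and the `i`-th power
of `a`. -/
def signSet (a y : List Bool) (U : List Data) : List Data :=
  (U.foldl (fun s x => (cmul a s.1, if dot y s.1 then x :: s.2 else s.2)) (unitVec a, [])).2

/-- The first component of the state runs through the powers of `a`, applied to the start vector `w`. -/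
theorem foldl_signSet (a y : List Bool) (U : List Data) (w : List Bool) (acc : List Data) :
    (U.foldl (fun s x => (cmul a s.1, if dot y s.1 then x :: s.2 else s.2)) (w, acc)).1 =
        (cmul a)^[U.length] w ∧
      ∃ l : List Data, l.Sublist U ∧ (U.Nodup → ∀ (i : ℕ) (hi : i < U.length),
        U[i] ∈ l ↔ dot y ((cmul a)^[i] w) = true) ∧
      (U.foldl (fun s x => (cmul a s.1, if dot y s.1 then x :: s.2 else s.2)) (w, acc)).2 =
        l.reverse ++ acc := by
  induction U generalizing w acc with
  | nil => exact ⟨rfl, [], by simp⟩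
  | cons x U ih =>
    obtain ⟨h1, l, h2, h3, h4⟩ := ih (cmul a w) (if dot y w then x :: acc else acc)
    refine ⟨by rw [List.foldl_cons, h1]; rfl, if dot y w then x :: l else l, ?_, ?_, ?_⟩
    · split
      · exact h2.cons_cons x
      · exact h2.cons x
    · intro hU i hi
      rw [List.nodup_cons] at hU
      cases i with
      | zero =>
        have : x ∉ l := fun h => hU.1 (h2.subset h)
        simp only [List.getElem_cons_zero, Function.iterate_zero, id]
        split <;> simp_all
      | succ i =>
        have hi' : i < U.length := by simpa using hi
        have hx : U[i] ≠ x := fun h => hU.1 (h ▸ List.getElem_mem hi')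
        simp only [List.getElem_cons_succ, Function.iterate_succ_apply]
        rw [← h3 hU.2 i hi']
        split <;> simp [hx]
    · rw [List.foldl_cons, h4]
      split <;> simp

theorem mem_signSet {a y : List Bool} {U : List Data} (h : U.Nodup) {i : ℕ} (hi : i < U.length) :
    U[i] ∈ signSet a y U ↔ dot y (powVec a i) = true := by
  obtain ⟨-, l, -, h3, h4⟩ := foldl_signSet a y U (unitVec a) []
  rw [signSet, h4, List.append_nil, List.mem_reverse, h3 h i hi]; rfl

theorem PT.signSet {f g : α → List Bool} {U : α → List Data} (hf : PT f) (hg : PT g) (hU : PT U) :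
    PT (fun a => signSet (f a) (g a) (U a)) := by
  refine PT.snd' (foldl (step := fun p : α × (List Bool × List Data) × Data =>
    (DiverseMultistage.cmul (f p.1) p.2.1.1, if DiverseMultistage.dot (g p.1) p.2.1.1 then
      p.2.2 :: p.2.1.2 else p.2.1.2)) hU (hf.unitVec.pair (const []))
      (((hf.comp fst).cmul snd.fst'.fst').pair (((hg.comp fst).dot snd.fst'.fst').cond
        (snd.snd'.cons snd.fst'.snd') snd.fst'.snd'))
      (B := fun a => ((sz (f a) + 1) * 4 + 1) + sz (U a) + 1)
      ((((((hf.size.add (.const 1)).mul (.const 4)).add (.const 1))).add hU.size).add (.const 1)) ?_)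
  intro a l' hl
  obtain ⟨h1, l, h2, -, h4⟩ := foldl_signSet (f a) (g a) l' (DiverseMultistage.unitVec (f a)) []
  rw [← Prod.mk.eta (p := List.foldl _ _ l'), sz_pair, h1, h4, List.append_nil, sz_reverse]
  have h5 := sz_le_of_sublist (h2.trans hl.sublist)
  have h6 : ((DiverseMultistage.cmul (f a))^[l'.length] (DiverseMultistage.unitVec (f a))).length ≤
      (f a).length + 1 := by
    have : ∀ n, ((DiverseMultistage.cmul (f a))^[n] (DiverseMultistage.unitVec (f a))).length =
        (DiverseMultistage.unitVec (f a)).length := by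
      intro n
      induction n with
      | zero => rfl
      | succ n ih =>
        rw [Function.iterate_succ_apply', length_cmul _ _, ih]
        rw [← List.length_pos_iff, ih]; simp [DiverseMultistage.unitVec]
    rw [this]; simp [DiverseMultistage.unitVec]
  have h7 := sz_bits_le ((DiverseMultistage.cmul (f a))^[l'.length] (DiverseMultistage.unitVec (f a)))
  have h8 := length_le_sz (f a)
  omega

/-- All concatenations of three elements of `L`. -/
def triple (L : List (List Bool)) : List (List Bool) :=
  (L ×ˢ L ×ˢ L).map fun p => p.1 ++ (p.2.1 ++ p.2.2)

/-- `L` consists of all bit vectors of length `3 ^ j`, for some `j`. -/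
def IsBitCube (L : List (List Bool)) (j : ℕ) : Prop :=
  L.Nodup ∧ ∀ v, v ∈ L ↔ v.length = 3 ^ j

theorem IsBitCube.toFinset {L : List (List Bool)} {j : ℕ} (h : IsBitCube L j) :
    L.toFinset = bitVecs (3 ^ j) := by
  ext v; rw [List.mem_toFinset, h.2, mem_bitVecs]

theorem IsBitCube.length {L : List (List Bool)} {j : ℕ} (h : IsBitCube L j) :
    L.length = 2 ^ 3 ^ j := by
  rw [← List.toFinset_card_of_nodup h.1, h.toFinset, card_bitVecs]

theorem IsBitCube.sz_le {L : List (List Bool)} {j : ℕ} (h : IsBitCube L j) :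
    sz L ≤ L.length * (L.length * 4 + 2) + 1 := by
  refine sz_le_of_forall (B := L.length * 4 + 1) fun v hv => (sz_bits_le v).trans ?_
  have : v.length ≤ L.length := by
    rw [(h.2 v).1 hv, h.length]; exact Nat.lt_two_pow_self.le
  omega

theorem IsBitCube.triple {L : List (List Bool)} {j : ℕ} (h : IsBitCube L j) :
    IsBitCube (triple L) (j + 1) := by
  constructor
  · refine List.Nodup.map_on ?_ (h.1.product (h.1.product h.1))
    rintro ⟨a, b, c⟩ h1 ⟨a', b', c'⟩ h2 heq
    simp only [List.mem_product, h.2] at h1 h2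
    obtain ⟨rfl, h3⟩ := List.append_inj heq (h1.1.trans h2.1.symm)
    obtain ⟨rfl, rfl⟩ := List.append_inj h3 (h1.2.1.trans h2.2.1.symm)
    rfl
  · intro v
    simp only [DiverseMultistage.triple, List.mem_map, Prod.exists, List.mem_product, h.2]
    constructor
    · rintro ⟨a, b, c, ⟨ha, hb, hc⟩, rfl⟩
      simp only [List.length_append, ha, hb, hc]; ring
    · intro hv
      have h3 : 3 ^ (j + 1) = 3 ^ j + (3 ^ j + 3 ^ j) := by ring
      refine ⟨v.take (3 ^ j), (v.drop (3 ^ j)).take (3 ^ j), (v.drop (3 ^ j)).drop (3 ^ j), ?_, ?_⟩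
      · simp only [List.length_take, List.length_drop]; omega
      · rw [List.take_append_drop, List.take_append_drop]

theorem PT.triple {f : α → List (List Bool)} (hf : PT f) : PT (fun a => triple (f a)) :=
  (hf.product (hf.product hf)).map
    (f := fun q : α × (List Bool × List Bool × List Bool) => q.2.1 ++ (q.2.2.1 ++ q.2.2.2))
    (snd.fst'.append (snd.snd'.fst'.append snd.snd'.snd'))

/-- One round of the enumeration of bit vectors: the length is tripled unless there are at least
`X` vectors already. -/
def growBits (X : ℕ) (L : List (List Bool)) : List (List Bool) :=
  if decide (X ≤ L.length) then L else triple L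

/-- All bit vectors of some length `3 ^ j`, at least `X` and not too many of them. -/
def manyBits (X : ℕ) : List (List Bool) :=
  (List.replicate X Data.nil).foldl (fun L _ => growBits X L) [[false], [true]]

/-- The number of bit vectors is at most cubed by each round, which is why its final value is
polynomial in `X`. -/
theorem foldl_growBits (X : ℕ) (l : List Data) :
    ∃ j, IsBitCube (l.foldl (fun L _ => growBits X L) [[false], [true]]) j ∧
      (X ≤ 2 ^ 3 ^ j ∨ l.length ≤ j) ∧ 2 ^ 3 ^ j ≤ X ^ 3 + 2 := by
  induction l using List.reverseRecOn with
  | nil =>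
    refine ⟨0, ⟨by simp, fun v => ?_⟩, by simp, by simp⟩
    match v with
    | [] => simp
    | [b] => cases b <;> simp
    | _ :: _ :: _ => simp
  | append_singleton l x ih =>
    obtain ⟨j, h1, h2, h3⟩ := ih
    rw [List.foldl_append, List.foldl_cons, List.foldl_nil, growBits, h1.length]
    by_cases h : X ≤ 2 ^ 3 ^ j
    · rw [if_pos (by simpa using h)]
      exact ⟨j, h1, .inl h, h3⟩
    · rw [if_neg (by simpa using h)]
      refine ⟨j + 1, h1.triple, .inr ?_, ?_⟩
      · rw [List.length_append, List.length_singleton]; omega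
      · rw [pow_succ 3 j, pow_mul]
        exact (Nat.pow_le_pow_left (show 2 ^ 3 ^ j ≤ X by omega) 3).trans (by omega)

theorem manyBits_spec (X : ℕ) : ∃ j, IsBitCube (manyBits X) j ∧ X ≤ 2 ^ 3 ^ j := by
  obtain ⟨j, h1, h2, -⟩ := foldl_growBits X (List.replicate X Data.nil)
  refine ⟨j, h1, h2.elim id fun h => ?_⟩
  rw [List.length_replicate] at h
  calc X ≤ j := h
    _ ≤ 3 ^ j := (Nat.lt_pow_self (by norm_num)).le
    _ ≤ _ := Nat.lt_two_pow_self.le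

theorem PT.manyBits {f : α → ℕ} (hf : PT f) : PT (fun a => manyBits (f a)) := by
  refine foldl (step := fun p : α × List (List Bool) × Data => growBits (f p.1) p.2.1) hf.replicate
    (const [[false], [true]])
    (((hf.comp fst).le snd.fst'.length).cond snd.fst' snd.fst'.triple)
    (B := fun a => (f a ^ 3 + 2) * ((f a ^ 3 + 2) * 4 + 2) + 1) ?_ ?_
  · have h : PB fun a => f a := hf.size.mono fun a => by rw [sz_nat]; omega
    have h' := (h.pow 3).add (.const 2)
    exact (h'.mul ((h'.mul (.const 4)).add (.const 2))).add (.const 1)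
  · intro a l' _
    obtain ⟨j, h1, -, h3⟩ := foldl_growBits (f a) l'
    refine h1.sz_le.trans ?_
    rw [h1.length]
    gcongr

/-! ### Small auxiliary functions -/

/-- The list of the elements of `l` without repetitions. -/
def distinct (l : List Data) : List Data :=
  l.foldl (fun s x => if decide (x ∈ s) then s else x :: s) []

theorem foldl_distinct (l : List Data) (s : List Data) (hs : s.Nodup) :
    (l.foldl (fun s x => if decide (x ∈ s) then s else x :: s) s).Nodup ∧
      (∀ x, x ∈ l.foldl (fun s x => if decide (x ∈ s) then s else x :: s) s ↔ x ∈ l ∨ x ∈ s) ∧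
      sz (l.foldl (fun s x => if decide (x ∈ s) then s else x :: s) s) + 1 ≤ sz l + sz s := by
  induction l generalizing s with
  | nil => simp [hs]
  | cons a l ih =>
    rw [List.foldl_cons]
    by_cases h : a ∈ s
    · rw [if_pos (by simpa using h)]
      obtain ⟨h1, h2, h3⟩ := ih s hs
      refine ⟨h1, fun x => ?_, by simp only [sz_cons]; omega⟩
      rw [h2, List.mem_cons]
      constructor
      · tauto
      · rintro ((rfl | h) | h) <;> tauto
    · rw [if_neg (by simpa using h)]
      obtain ⟨h1, h2, h3⟩ := ih (a :: s) (List.nodup_cons.2 ⟨h, hs⟩)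
      refine ⟨h1, fun x => ?_, by simp only [sz_cons] at *; omega⟩
      rw [h2, List.mem_cons, List.mem_cons]; tauto

theorem nodup_distinct (l : List Data) : (distinct l).Nodup := (foldl_distinct l [] (by simp)).1

theorem mem_distinct {l : List Data} {x : Data} : x ∈ distinct l ↔ x ∈ l := by
  simpa [distinct] using (foldl_distinct l [] (by simp)).2.1 x

theorem PT.distinct {f : α → List Data} (hf : PT f) : PT (fun a => distinct (f a)) := by
  have h : PT (fun l : List Data => DiverseMultistage.distinct l) := by
    refine foldl (step := fun p : List Data × List Data × Data =>
      if decide (p.2.2 ∈ p.2.1) then p.2.1 else p.2.2 :: p.2.1) id (const [])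
      ((snd.snd'.mem snd.fst').cond snd.fst' (snd.snd'.cons snd.fst')) .size ?_
    intro l l' hl
    have h1 := (foldl_distinct l' [] (by simp)).2.2
    have h2 := sz_le_of_sublist hl.sublist
    simp only [sz_nil] at h1
    have h3 : sz (l'.foldl (fun s x => if decide (x ∈ s) then s else x :: s) []) ≤ sz l := by omega
    exact h3
  exact h.comp hf

/-- The numbers below `n`, in decreasing order. -/
def below (n : ℕ) : List ℕ := (List.replicate n Data.nil).foldl (fun s _ => s.length :: s) []

theorem foldl_below (l : List Data) (s : List ℕ) (hs : ∀ x, x ∈ s ↔ x < s.length) :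
    (l.foldl (fun s _ => s.length :: s) s).length = l.length + s.length ∧
      ∀ x, x ∈ l.foldl (fun s _ => s.length :: s) s ↔ x < l.length + s.length := by
  induction l generalizing s with
  | nil => simpa using hs
  | cons a l ih =>
    obtain ⟨h1, h2⟩ := ih (s.length :: s) (by intro x; simp [hs]; omega)
    simp only [List.length_cons, List.foldl_cons] at *
    exact ⟨by omega, fun x => by rw [h2]; omega⟩

theorem mem_below {n x : ℕ} : x ∈ below n ↔ x < n := by
  simpa [below] using (foldl_below (List.replicate n Data.nil) [] (by simp)).2 x

theorem PT.below {f : α → ℕ} (hf : PT f) : PT (fun a => below (f a)) := by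
  refine foldl (step := fun p : α × List ℕ × Data => p.2.1.length :: p.2.1) hf.replicate
    (const []) (snd.fst'.length.cons snd.fst') (B := fun a => sz (f a) * (sz (f a) + 1) + 1)
    ((hf.size.mul (hf.size.add (.const 1))).add (.const 1)) ?_
  intro a l' hl
  obtain ⟨h1, h2⟩ := foldl_below l' [] (by simp)
  have h3 := hl.length_le
  simp only [List.length_replicate, List.length_nil, add_zero] at h1 h2 h3
  refine (sz_le_of_forall (B := sz (f a)) fun x hx => ?_).trans ?_
  · have := (h2 x).1 hx
    rw [sz_nat, sz_nat]; omega
  · rw [h1]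
    have : l'.length ≤ sz (f a) := by rw [sz_nat]; omega
    gcongr

/-- An upper bound for the binary logarithm of `n`, found by repeated doubling. -/
def logBound (n : ℕ) : ℕ :=
  ((List.replicate n Data.nil).foldl
    (fun s _ => if decide (n ≤ s.2) then s else (s.1 + 1, s.2 + s.2)) (0, 1)).1

theorem foldl_logBound (n : ℕ) (l : List Data) :
    ∃ m, l.foldl (fun s _ => if decide (n ≤ s.2) then s else (s.1 + 1, s.2 + s.2)) (0, 1) =
      (m, 2 ^ m) ∧ (n ≤ 2 ^ m ∨ l.length ≤ m) ∧ 2 ^ m ≤ 2 * n + 1 := by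
  induction l using List.reverseRecOn with
  | nil => exact ⟨0, by simp⟩
  | append_singleton l x ih =>
    obtain ⟨m, h1, h2, h3⟩ := ih
    rw [List.foldl_append, List.foldl_cons, List.foldl_nil, h1]
    by_cases h : n ≤ 2 ^ m
    · rw [if_pos (by simpa using h)]
      exact ⟨m, rfl, .inl h, h3⟩
    · rw [if_neg (by simpa using h)]
      refine ⟨m + 1, by rw [pow_succ, mul_two], .inr ?_, by rw [pow_succ]; omega⟩
      rw [List.length_append, List.length_singleton]; omega

theorem logBound_spec (n : ℕ) : n ≤ 2 ^ logBound n ∧ 2 ^ logBound n ≤ 2 * n + 1 := by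
  obtain ⟨m, h1, h2, h3⟩ := foldl_logBound n (List.replicate n Data.nil)
  rw [logBound, h1]
  refine ⟨h2.elim id fun h => ?_, h3⟩
  rw [List.length_replicate] at h
  exact h.trans Nat.lt_two_pow_self.le

theorem PT.logBound {f : α → ℕ} (hf : PT f) : PT (fun a => logBound (f a)) := by
  refine PT.fst' (foldl (step := fun p : α × (ℕ × ℕ) × Data =>
    if decide (f p.1 ≤ p.2.1.2) then p.2.1 else (p.2.1.1 + 1, p.2.1.2 + p.2.1.2)) hf.replicate
    (const (0, 1)) (((hf.comp fst).le snd.fst'.snd').cond snd.fst'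
      (snd.fst'.fst'.succ.pair (snd.fst'.snd'.add snd.fst'.snd')))
    (B := fun a => sz (f a) * 4 + 10) ((hf.size.mul (.const 4)).add (.const 10)) ?_)
  intro a l' _
  obtain ⟨m, h1, -, h3⟩ := foldl_logBound (f a) l'
  have h4 : m < 2 ^ m := Nat.lt_two_pow_self
  rw [h1, sz_pair, sz_nat, sz_nat, sz_nat]; omega

/-! ### The family of sign sets -/

/-- The typed form of the encoding of an instance: the listed base set and further data. -/
abbrev Item : Type := List Data × Data

/-- The elements that occur in some base set. -/
def elements (L : List Item) : List Data := distinct (L.flatMap fun x => x.1)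

/-- The sets used to split the symmetric differences. The number `b` stands for `2 ^ l`. -/
def signFamily (L : List Item) (b : ℕ) : List (List Data) :=
  let B := manyBits (((elements L).length + 2) * b * (((elements L).length + 2) * b *
    (((elements L).length + 2) * b)))
  (B ×ˢ B).map fun p => signSet p.1 p.2 (elements L)

theorem signFamily_ne_nil (L : List Item) (b : ℕ) : signFamily L b ≠ [] := by
  obtain ⟨j, hj, -⟩ := manyBits_spec (((elements L).length + 2) * b *
    (((elements L).length + 2) * b * (((elements L).length + 2) * b)))
  have h := hj.length
  have h' := Nat.one_le_two_pow (n := 3 ^ j)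
  intro h0
  have := congrArg List.length h0
  simp only [signFamily, List.length_map, List.length_product, List.length_nil, h] at this
  simp at this

/-- Some set of the family splits the difference of `S` and `S'` in an unbalanced way. -/
theorem exists_mem_signFamily (L : List Item) (l : ℕ) (S S' : Finset Data)
    (hS : ∀ x ∈ S, x ∈ elements L) (hS' : ∀ x ∈ S', x ∈ elements L)
    (hl : l ≤ (symmDiff S S').card) :
    ∃ P ∈ signFamily L (2 ^ l),
      (l : ℤ) ≤ |((S.filter (· ∈ P)).card : ℤ) - (S'.filter (· ∈ P)).card| +
        |((S.filter (· ∉ P)).card : ℤ) - (S'.filter (· ∉ P)).card| := by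
  set U := elements L with hU
  have hnd : U.Nodup := nodup_distinct _
  set N := U.length with hN
  set Y := (N + 2) * 2 ^ l with hY
  obtain ⟨j, hj, hX⟩ := manyBits_spec (Y * (Y * Y))
  have hY2 : 2 ≤ Y := by
    have := Nat.one_le_two_pow (n := l)
    nlinarith
  obtain ⟨k, rfl⟩ : ∃ k, j = k + 1 := by
    cases j with
    | zero => exfalso; simp at hX; nlinarith [Nat.mul_le_mul hY2 hY2]
    | succ k => exact ⟨k, rfl⟩
  -- asking for `Y ^ 3` vectors of length `3 ^ (k + 1)` gives the bound `Y ≤ 2 ^ 3 ^ k`, which the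
  -- estimate of the bias needs
  have hYk : Y ≤ 2 ^ 3 ^ k := by
    by_contra! hlt
    have : 2 ^ 3 ^ (k + 1) < Y * (Y * Y) := by
      calc 2 ^ 3 ^ (k + 1) = (2 ^ 3 ^ k) ^ 3 := by rw [← pow_mul, pow_succ]
        _ < Y ^ 3 := Nat.pow_lt_pow_left hlt (by norm_num)
        _ = _ := by ring
    omega
  have hbound : 2 ^ l * (N + 1) * N < 2 ^ (2 * 3 ^ k) := by
    have h1 : 1 ≤ 2 ^ l := Nat.one_le_two_pow
    calc 2 ^ l * (N + 1) * N < 2 ^ l * (N + 2) * (2 ^ l * (N + 2)) := by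
          have h2 : N < 2 ^ l * (N + 2) := by nlinarith
          have h3 : 2 ^ l * (N + 1) ≤ 2 ^ l * (N + 2) := by gcongr; omega
          have h4 : 0 < 2 ^ l * (N + 2) := by positivity
          exact (Nat.mul_le_mul_right _ h3).trans_lt (Nat.mul_lt_mul_of_pos_left h2 h4)
      _ = Y * Y := by rw [hY]; ring
      _ ≤ 2 ^ 3 ^ k * 2 ^ 3 ^ k := Nat.mul_le_mul hYk hYk
      _ = _ := by rw [← pow_add, two_mul]
  -- positions in `U` of the elements of the symmetric difference
  have hidx : ∀ x ∈ U, U.idxOf x < N := fun x hx => List.idxOf_lt_length_iff.2 hx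
  have hinj : Set.InjOn (fun x => U.idxOf x) (symmDiff S S' : Finset Data) := by
    intro x hx y hy hxy
    have hx' : x ∈ U := (Finset.mem_union.1 (Finset.symmDiff_subset_union hx)).elim (hS x) (hS' x)
    exact (List.idxOf_inj hx').1 hxy
  obtain ⟨a, ha, y, hy, hsum⟩ := exists_sign_sum_ge k l N hbound
    ((symmDiff S S').image fun x => U.idxOf x) (by
      intro i hi
      obtain ⟨x, hx, rfl⟩ := Finset.mem_image.1 hi
      have hx' : x ∈ U := (Finset.mem_union.1 (Finset.symmDiff_subset_union hx)).elim (hS x) (hS' x)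
      exact Finset.mem_range.2 (hidx x hx'))
    (by rwa [Finset.card_image_of_injOn hinj])
    (fun i => if U.getD i Data.nil ∈ S then 1 else -1) (fun i => by split <;> simp)
  rw [Finset.sum_image hinj] at hsum
  refine ⟨signSet a y U, ?_, ?_⟩
  · rw [← hj.toFinset, List.mem_toFinset] at ha hy
    exact List.mem_map.2 ⟨(a, y), List.mem_product.2 ⟨ha, hy⟩, rfl⟩
  · set P := signSet a y U with hP
    have hterm : ∀ x ∈ symmDiff S S',
        (if U.getD (U.idxOf x) Data.nil ∈ S then (1 : ℤ) else -1) *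
          sgn (dot y (powVec a (U.idxOf x))) =
        (if x ∈ S then 1 else -1) * (if x ∈ P then -1 else 1) := by
      intro x hx
      have hx' : x ∈ U := (Finset.mem_union.1 (Finset.symmDiff_subset_union hx)).elim (hS x) (hS' x)
      have h1 := hidx x hx'
      have h2 : U[U.idxOf x] = x := List.getElem_idxOf h1
      have h3 := mem_signSet (a := a) (y := y) hnd h1
      rw [h2] at h3
      rw [List.getD_eq_getElem _ _ h1, h2, sgn]
      simp only [← h3, ← hP]
    rw [Finset.sum_congr rfl hterm] at hsum
    have hsplit : ∀ Q : Finset Data, ((Q.filter (· ∉ P)).card : ℤ) - (Q.filter (· ∈ P)).card =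
        ∑ x ∈ Q, (if x ∈ P then (-1 : ℤ) else 1) := by
      intro Q
      rw [Finset.sum_ite, Finset.sum_const, Finset.sum_const]; simp; ring
    have htot : ∑ x ∈ symmDiff S S', ((if x ∈ S then (1 : ℤ) else -1) * if x ∈ P then -1 else 1) =
        ∑ x ∈ S, (if x ∈ P then (-1 : ℤ) else 1) - ∑ x ∈ S', (if x ∈ P then (-1 : ℤ) else 1) := by
      have hd : Disjoint (S \ S') (S' \ S) := disjoint_sdiff_sdiff
      rw [show symmDiff S S' = (S \ S') ∪ (S' \ S) from rfl, Finset.sum_union hd,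
        ← Finset.sum_inter_add_sum_sdiff S S', ← Finset.sum_inter_add_sum_sdiff S' S,
        Finset.inter_comm S' S]
      have e1 : ∑ x ∈ S \ S', ((if x ∈ S then (1 : ℤ) else -1) * if x ∈ P then -1 else 1) =
          ∑ x ∈ S \ S', (if x ∈ P then (-1 : ℤ) else 1) :=
        Finset.sum_congr rfl fun x hx => by rw [if_pos (Finset.mem_sdiff.1 hx).1, one_mul]
      have e2 : ∑ x ∈ S' \ S, ((if x ∈ S then (1 : ℤ) else -1) * if x ∈ P then -1 else 1) =
          -∑ x ∈ S' \ S, (if x ∈ P then (-1 : ℤ) else 1) := by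
        rw [← Finset.sum_neg_distrib]
        exact Finset.sum_congr rfl fun x hx => by
          rw [if_neg (Finset.mem_sdiff.1 hx).2, neg_one_mul]
      rw [e1, e2]; ring
    rw [htot, ← hsplit, ← hsplit] at hsum
    have h1 := neg_abs_le (((S.filter (· ∈ P)).card : ℤ) - (S'.filter (· ∈ P)).card)
    have h2 := le_abs_self (((S.filter (· ∉ P)).card : ℤ) - (S'.filter (· ∉ P)).card)
    linarith

/-- Counting inside and outside of `P` gives a lower bound for the symmetric difference. -/
theorem le_card_symmDiff (S S' : Finset Data) (P : List Data) :
    |((S.filter (· ∈ P)).card : ℤ) - (S'.filter (· ∈ P)).card| +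
        |((S.filter (· ∉ P)).card : ℤ) - (S'.filter (· ∉ P)).card| ≤ (symmDiff S S').card := by
  have key : ∀ A B : Finset Data, |(A.card : ℤ) - B.card| ≤ (symmDiff A B).card := by
    intro A B
    have h1 := Finset.card_inter_add_card_sdiff A B
    have h2 := Finset.card_inter_add_card_sdiff B A
    rw [Finset.inter_comm] at h2
    have h3 : (symmDiff A B).card = (A \ B).card + (B \ A).card :=
      Finset.card_union_of_disjoint disjoint_sdiff_sdiff
    rw [abs_le]; omega
  have h1 := key (S.filter (· ∈ P)) (S'.filter (· ∈ P))
  have h2 := key (S.filter (· ∉ P)) (S'.filter (· ∉ P))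
  have h3 : symmDiff (S.filter (· ∈ P)) (S'.filter (· ∈ P)) = (symmDiff S S').filter (· ∈ P) := by
    ext x; simp only [Finset.mem_symmDiff, Finset.mem_filter]; tauto
  have h4 : symmDiff (S.filter (· ∉ P)) (S'.filter (· ∉ P)) = (symmDiff S S').filter (· ∉ P) := by
    ext x; simp only [Finset.mem_symmDiff, Finset.mem_filter]; tauto
  have h5 := Finset.card_filter_add_card_filter_not (s := symmDiff S S') (· ∈ P)
  rw [h3] at h1; rw [h4] at h2
  omega

theorem PT.elements {f : α → List Item} (hf : PT f) : PT (fun a => elements (f a)) :=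
  (hf.flatMap (f := fun p : α × Item => p.2.1) snd.fst').distinct

theorem PT.signFamily {f : α → List Item} {g : α → ℕ} (hf : PT f) (hg : PT g) :
    PT (fun a => signFamily (f a) (g a)) := by
  have h1 := (hf.elements.length.add (const 2)).mul hg
  have h2 := (h1.mul (h1.mul h1)).manyBits
  exact (h2.product h2).map
    (f := fun p : α × (List Bool × List Bool) =>
      DiverseMultistage.signSet p.2.1 p.2.2 (DiverseMultistage.elements (f p.1)))
    (snd.fst'.signSet snd.snd' (hf.elements.comp fst))

/-! ### The colored instances that are to be solved -/

/-- A colored instance: an item, the two sets that define the coloring, and the numbers of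
elements to be chosen of the colors `0`, `1` and `2`, `3`. -/
abbrev Key : Type := Item × (List Data × List Data) × (ℕ × ℕ) × (ℕ × ℕ)

/-- The color of an element shows in which of the two sets it is. -/
def color (a b : List Data) (x : Data) : Fin 4 :=
  if decide (x ∈ a) then (if decide (x ∈ b) then 3 else 2) else (if decide (x ∈ b) then 1 else 0)

/-- The numbers of elements of the four colors. -/
def Key.counts (k : Key) : Fin 4 → ℕ := ![k.2.2.1.1, k.2.2.1.2, k.2.2.2.1, k.2.2.2.2]

/-- The encoding of a colored instance. -/
def Key.code (k : Key) : Data :=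
  enc (k.1, k.1.1.map fun x => (color k.2.1.1 k.2.1.2 x : ℕ),
    [k.2.2.1.1, k.2.2.1.2, k.2.2.2.1, k.2.2.2.2])

theorem PT.keyCode {f : α → Key} (hf : PT f) : PT (fun a => (f a).code) := by
  have hc : PT (fun p : Key × Data => (color p.1.2.1.1 p.1.2.1.2 p.2 : ℕ)) := by
    refine (((snd.mem fst.snd'.fst'.fst').cond
      ((snd.mem fst.snd'.fst'.snd').cond (const 3) (const 2))
      ((snd.mem fst.snd'.fst'.snd').cond (const 1) (const 0)) :
        PT (fun p : Key × Data => (_ : ℕ)))).cast_out fun p => ?_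
    congr 1
    simp only [color]
    split <;> split <;> rfl
  have h : PT (fun k : Key => (k.1, k.1.1.map fun x => (color k.2.1.1 k.2.1.2 x : ℕ),
      [k.2.2.1.1, k.2.2.1.2, k.2.2.2.1, k.2.2.2.2])) :=
    fst.pair ((fst.fst'.map hc).pair (snd.snd'.fst'.fst'.cons (snd.snd'.fst'.snd'.cons
      (snd.snd'.snd'.fst'.cons (snd.snd'.snd'.snd'.cons (const []))))))
  exact (h.comp hf).cast_out fun _ => rfl

/-- All colored instances that are of interest. -/
def allKeys (L : List Item) (b : ℕ) : List Key :=
  let F := signFamily L b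
  let R := below ((elements L).length + 1)
  L ×ˢ ((F ×ˢ F) ×ˢ ((R ×ˢ R) ×ˢ (R ×ˢ R)))

theorem PT.allKeys {f : α → List Item} {g : α → ℕ} (hf : PT f) (hg : PT g) :
    PT (fun a => allKeys (f a) (g a)) := by
  have hF := hf.signFamily hg
  have hR := (hf.elements.length.add (const 1)).below
  exact hf.product ((hF.product hF).product ((hR.product hR).product (hR.product hR)))

/-! ### Dynamic programming over the stages -/

/-- The distance of two pairs of numbers. -/
def dist (p q : ℕ × ℕ) : ℕ := (p.1 - q.1) + (q.1 - p.1) + ((p.2 - q.2) + (q.2 - p.2))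

/-- The states reached at the stage `x` from the states `R` of the stage before. A state consists of
a set `P` and the numbers of elements of a solution inside and outside of `P`. -/
def stageStep (pos : List Key) (l : ℕ) (R : List (List Data × ℕ × ℕ)) (x : Item) :
    List (List Data × ℕ × ℕ) :=
  (pos.filter fun k => decide (k.1 = x) && R.any fun s => decide (s.1 = k.2.1.1) &&
    decide (l ≤ dist s.2 (k.2.2.2.1 + k.2.2.2.2, k.2.2.1.1 + k.2.2.1.2))).map
  fun k => (k.2.1.2, k.2.2.1.2 + k.2.2.2.2, k.2.2.1.1 + k.2.2.2.1)

/-- The states before the first stage. The numbers are chosen such that every solution is far away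
from them. -/
def startStates (L : List Item) (b l : ℕ) : List (List Data × ℕ × ℕ) :=
  (signFamily L b).map fun a => (a, (elements L).length + l, 0)

/-- The answer, computed from the list `pos` of the solvable colored instances. -/
def decideDiverse (pos : List Key) (L : List Item) (b l : ℕ) : Bool :=
  !(L.foldl (stageStep pos l) (startStates L b l)).isEmpty

theorem PT.dist {f g : α → ℕ × ℕ} (hf : PT f) (hg : PT g) : PT (fun a => dist (f a) (g a)) :=
  ((hf.fst'.sub hg.fst').add (hg.fst'.sub hf.fst')).add
    ((hf.snd'.sub hg.snd').add (hg.snd'.sub hf.snd'))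

theorem PT.stageStep {f : α → List Key} {g : α → ℕ} {R : α → List (List Data × ℕ × ℕ)}
    {x : α → Item} (hf : PT f) (hg : PT g) (hR : PT R) (hx : PT x) :
    PT (fun a => stageStep (f a) (g a) (R a) (x a)) := by
  refine (hf.filter (f := fun p : α × Key => decide (p.2.1 = x p.1) && (R p.1).any fun s =>
    decide (s.1 = p.2.2.1.1) && decide (g p.1 ≤ DiverseMultistage.dist s.2
      (p.2.2.2.2.1 + p.2.2.2.2.2, p.2.2.2.1.1 + p.2.2.2.1.2))) ?_).map
    (f := fun p : α × Key => (p.2.2.1.2, p.2.2.2.1.2 + p.2.2.2.2.2, p.2.2.2.1.1 + p.2.2.2.2.1)) ?_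
  · refine (snd.fst'.beq (hx.comp fst)).and ((hR.comp fst).any
      (f := fun q : (α × Key) × (List Data × ℕ × ℕ) => decide (q.2.1 = q.1.2.2.1.1) &&
        decide (g q.1.1 ≤ DiverseMultistage.dist q.2.2
          (q.1.2.2.2.2.1 + q.1.2.2.2.2.2, q.1.2.2.2.1.1 + q.1.2.2.2.1.2))) ?_)
    have hk : PT (fun q : (α × Key) × (List Data × ℕ × ℕ) => q.1.2.2) := fst.snd'.snd'
    exact (snd.fst'.beq hk.fst'.fst').and (((hg.comp fst).comp fst).le (snd.snd'.dist
      ((hk.snd'.snd'.fst'.add hk.snd'.snd'.snd').pair (hk.snd'.fst'.fst'.add hk.snd'.fst'.snd'))))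
  · have hk : PT (fun q : α × Key => q.2.2) := snd.snd'
    exact hk.fst'.snd'.pair ((hk.snd'.fst'.snd'.add hk.snd'.snd'.snd').pair
      (hk.snd'.fst'.fst'.add hk.snd'.snd'.fst'))

theorem PT.decideDiverse {pos : α → List Key} {L : α → List Item} {b l : α → ℕ} (hp : PT pos)
    (hL : PT L) (hb : PT b) (hl : PT l) :
    PT (fun a => decideDiverse (pos a) (L a) (b a) (l a)) := by
  have hstart : PT (fun a => startStates (L a) (b a) (l a)) :=
    (hL.signFamily hb).map (f := fun p : α × List Data =>
      (p.2, (DiverseMultistage.elements (L p.1)).length + l p.1, 0))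
      (snd.pair ((((hL.elements.length).add hl).comp fst).pair (const 0)))
  refine PT.not (isEmpty (foldl (step := fun p : α × List (List Data × ℕ × ℕ) × Item =>
    DiverseMultistage.stageStep (pos p.1) (l p.1) p.2.1 p.2.2) hL hstart
    (stageStep (hp.comp fst) (hl.comp fst) snd.fst' snd.snd')
    (B := fun a => sz (startStates (L a) (b a) (l a)) + (sz (pos a) * (4 * sz (pos a) + 1) + 1))
    (hstart.size.add ((hp.size.mul (((PB.const 4).mul hp.size).add (.const 1))).add (.const 1)))
    ?_))
  intro a l' _
  rcases List.eq_nil_or_concat l' with rfl | ⟨l'', x, rfl⟩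
  · simp
  · rw [List.concat_eq_append, List.foldl_append, List.foldl_cons, List.foldl_nil]
    refine le_trans ?_ (Nat.le_add_left _ _)
    rw [DiverseMultistage.stageStep]
    refine (sz_le_of_forall (B := 4 * sz (pos a)) ?_).trans ?_
    · intro y hy
      obtain ⟨k, hk, rfl⟩ := List.mem_map.1 hy
      have := sz_le_of_mem (List.mem_of_mem_filter hk)
      obtain ⟨k1, ⟨k2, k3⟩, ⟨k4, k5⟩, k6, k7⟩ := k
      simp only [sz_pair, sz_nat] at *; omega
    · gcongr
      rw [List.length_map]
      exact (List.length_filter_le _ _).trans (length_le_sz _)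

/-! ### Correctness of the dynamic program -/

/-- The data of an instance without the proofs. -/
def Inst.item (I : Inst) : Item := (I.base, I.data)

theorem Inst.item_injective : Function.Injective Inst.item := by
  rintro ⟨a, _, _, b⟩ ⟨c, _, _, d⟩ h
  simp only [Inst.item, Prod.mk.injEq] at h
  obtain ⟨rfl, rfl⟩ := h
  rfl

theorem enc_list_data (l : List Data) : enc l = Data.ofList l :=
  congrArg Data.ofList (List.map_id l)

theorem Inst.enc_item (I : Inst) : enc I.item = I.code := by
  rw [Inst.item, enc_pair, Inst.code, enc_list_data]; rfl

/-- The code written for a key is the code of a colored instance in the sense of the problem. -/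
theorem Key.code_eq (k : Key) (I : Inst) (h : k.1 = I.item) :
    k.code = coloredCode I (color k.2.1.1 k.2.1.2) k.counts := by
  have h1 : k.1.1 = I.base := by rw [h]; rfl
  rw [Key.code, coloredCode, enc_pair, h, Inst.enc_item, enc_pair, ← h, h1]
  have h2 : enc (I.base.map fun x => (color k.2.1.1 k.2.1.2 x : ℕ)) =
      Data.ofList (I.base.map fun x => Data.ofNat (color k.2.1.1 k.2.1.2 x : ℕ)) := by
    change Data.ofList (List.map enc (List.map _ _)) = _
    rw [List.map_map]; rfl
  rw [h2]
  congr 2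

theorem le_dist_iff (l : ℕ) (p q : ℕ × ℕ) :
    l ≤ dist p q ↔ (l : ℤ) ≤ |(p.1 : ℤ) - q.1| + |(p.2 : ℤ) - q.2| := by
  unfold dist
  rcases abs_cases ((p.1 : ℤ) - q.1) with h | h <;> rcases abs_cases ((p.2 : ℤ) - q.2) with h' | h' <;>
    rw [h.1, h'.1] <;> omega

/-- The numbers of elements inside and outside of `a` and of `b` are sums of two color counts each. -/
theorem card_color (S : Finset Data) (a b : List Data) :
    ((S.filter fun x => color a b x = 2).card + (S.filter fun x => color a b x = 3).card =
        (S.filter (· ∈ a)).card ∧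
      (S.filter fun x => color a b x = 0).card + (S.filter fun x => color a b x = 1).card =
        (S.filter (· ∉ a)).card) ∧
    ((S.filter fun x => color a b x = 1).card + (S.filter fun x => color a b x = 3).card =
        (S.filter (· ∈ b)).card ∧
      (S.filter fun x => color a b x = 0).card + (S.filter fun x => color a b x = 2).card =
        (S.filter (· ∉ b)).card) := by
  simp only [Finset.card_filter, ← Finset.sum_add_distrib]
  refine ⟨⟨?_, ?_⟩, ?_, ?_⟩ <;> refine Finset.sum_congr rfl fun x _ => ?_ <;>
    by_cases ha : x ∈ a <;> by_cases hb : x ∈ b <;> simp [color, ha, hb]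

/-- The colored instance has a solution. -/
def Key.Solvable (Pb : Problem) (k : Key) : Prop :=
  ∃ I S, I.item = k.1 ∧ IsColoredSolution Pb I (color k.2.1.1 k.2.1.2) k.counts S

/-- The list `R` of states describes exactly the sets satisfying `Q`. -/
def Describes (F : List (List Data)) (R : List (List Data × ℕ × ℕ)) (Q : Finset Data → Prop) :
    Prop :=
  ∀ b u v, (b, u, v) ∈ R ↔
    b ∈ F ∧ ∃ S, Q S ∧ u = (S.filter (· ∈ b)).card ∧ v = (S.filter (· ∉ b)).card

theorem mem_stageStep {pos : List Key} {l : ℕ} {R : List (List Data × ℕ × ℕ)} {x : Item}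
    {b : List Data} {u v : ℕ} : (b, u, v) ∈ stageStep pos l R x ↔
      ∃ a n₀ n₁ n₂ n₃, (x, (a, b), (n₀, n₁), (n₂, n₃)) ∈ pos ∧
        (∃ p, (a, p) ∈ R ∧ l ≤ dist p (n₂ + n₃, n₀ + n₁)) ∧ u = n₁ + n₃ ∧ v = n₀ + n₂ := by
  simp only [stageStep, List.mem_map, List.mem_filter, Bool.and_eq_true, decide_eq_true_eq,
    List.any_eq_true, Prod.mk.injEq]
  constructor
  · rintro ⟨⟨y, ⟨a, b'⟩, ⟨n₀, n₁⟩, n₂, n₃⟩, ⟨hpos, rfl, ⟨a', p⟩, hR, rfl, hd⟩, rfl, rfl, rfl⟩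
    exact ⟨_, n₀, n₁, n₂, n₃, hpos, ⟨p, hR, hd⟩, rfl, rfl⟩
  · rintro ⟨a, n₀, n₁, n₂, n₃, hpos, ⟨p, hR, hd⟩, rfl, rfl⟩
    exact ⟨_, ⟨hpos, rfl, (a, p), hR, rfl, hd⟩, rfl, rfl, rfl⟩

section
variable {Pb : Problem} {L : List Item} {l : ℕ} {pos : List Key}

theorem card_le_elements {S : Finset Data} (h : ∀ x ∈ S, x ∈ elements L) :
    S.card ≤ (elements L).length :=
  (Finset.card_le_card (fun x hx => List.mem_toFinset.2 (h x hx))).trans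
    (List.toFinset_card_le _)

theorem subset_elements {I : Inst} (hI : I ∈ Pb.instances) (hL : I.item ∈ L) {S : Finset Data}
    (hS : S ∈ Pb.solutions I) : ∀ x ∈ S, x ∈ elements L := by
  intro x hx
  have := Pb.subset_base I hI S hS hx
  rw [Inst.baseSet, List.mem_toFinset] at this
  exact mem_distinct.2 (List.mem_flatMap.2 ⟨_, hL, this⟩)

/-- The common part of the first and the later stages of the dynamic program. -/
theorem describes_stageStep
    (hpos : ∀ k, k ∈ pos ↔ k ∈ allKeys L (2 ^ l) ∧ k.Solvable Pb) {I : Inst}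
    (hI : I ∈ Pb.instances) (hL : I.item ∈ L) {R : List (List Data × ℕ × ℕ)}
    {Q : Finset Data → Prop}
    (hQ : ∀ S' ∈ Pb.solutions I, Q S' ↔ ∃ a ∈ signFamily L (2 ^ l), ∃ p, (a, p) ∈ R ∧
      l ≤ dist p ((S'.filter (· ∈ a)).card, (S'.filter (· ∉ a)).card)) :
    Describes (signFamily L (2 ^ l)) (stageStep pos l R I.item)
      (fun S' => S' ∈ Pb.solutions I ∧ Q S') := by
  intro b u v
  rw [mem_stageStep]
  constructor
  · rintro ⟨a, n₀, n₁, n₂, n₃, hk, ⟨p, hR, hd⟩, rfl, rfl⟩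
    obtain ⟨hk, I', S', hI', hS', hc⟩ := (hpos _).1 hk
    obtain rfl := Inst.item_injective hI'
    simp only [allKeys, List.mem_product] at hk
    obtain ⟨⟨h1, h2⟩, h3, h4⟩ := card_color S' a b
    have c0 := hc 0
    have c1 := hc 1
    have c2 := hc 2
    have c3 := hc 3
    simp only [Key.counts, Matrix.cons_val] at c0 c1 c2 c3
    rw [c2, c3] at h1
    rw [c0, c1] at h2
    rw [c1, c3] at h3
    rw [c0, c2] at h4
    refine ⟨hk.2.1.2, S', ⟨hS', (hQ S' hS').2 ⟨a, hk.2.1.1, p, hR, ?_⟩⟩, h3, h4⟩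
    rwa [← h1, ← h2]
  · rintro ⟨hb, S', ⟨hS', hq⟩, rfl, rfl⟩
    obtain ⟨a, ha, p, hR, hd⟩ := (hQ S' hS').1 hq
    obtain ⟨⟨h1, h2⟩, h3, h4⟩ := card_color S' a b
    have hle : ∀ i, (S'.filter fun x => color a b x = i).card < (elements L).length + 1 :=
      fun i => Nat.lt_succ_of_le
        ((Finset.card_filter_le _ _).trans (card_le_elements (subset_elements hI hL hS')))
    refine ⟨a, _, _, _, _, (hpos _).2 ⟨?_, I, S', rfl, hS', ?_⟩, ⟨p, hR, ?_⟩, h3.symm, h4.symm⟩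
    · simp only [allKeys, List.mem_product, mem_below]
      exact ⟨hL, ⟨ha, hb⟩, ⟨hle 0, hle 1⟩, hle 2, hle 3⟩
    · intro i
      fin_cases i <;> rfl
    · rwa [h1, h2]

/-- At the first stage every solution is admitted, as the start states are far from all counts. -/
theorem describes_first (hpos : ∀ k, k ∈ pos ↔ k ∈ allKeys L (2 ^ l) ∧ k.Solvable Pb) {I : Inst}
    (hI : I ∈ Pb.instances) (hL : I.item ∈ L) :
    Describes (signFamily L (2 ^ l)) (stageStep pos l (startStates L (2 ^ l) l) I.item)
      (fun S' => S' ∈ Pb.solutions I) := by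
  have := describes_stageStep hpos hI hL (R := startStates L (2 ^ l) l) (Q := fun _ => True)
    (fun S' hS' => by
      refine ⟨fun _ => ?_, fun _ => trivial⟩
      obtain ⟨a, ha⟩ := List.exists_mem_of_ne_nil _ (signFamily_ne_nil L (2 ^ l))
      refine ⟨a, ha, _, List.mem_map.2 ⟨a, ha, rfl⟩, ?_⟩
      have h := (Finset.card_filter_le S' (· ∈ a)).trans
        (card_le_elements (subset_elements hI hL hS'))
      simp only [dist]; omega)
  simpa using this

/-- At a later stage the counts decide whether a solution is far from one of the stage before: the
family of sign sets is rich enough for one direction, and the lower bound for the symmetric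
difference gives the other one. -/
theorem describes_next (hpos : ∀ k, k ∈ pos ↔ k ∈ allKeys L (2 ^ l) ∧ k.Solvable Pb) {I : Inst}
    (hI : I ∈ Pb.instances) (hL : I.item ∈ L) {R : List (List Data × ℕ × ℕ)}
    {Q : Finset Data → Prop} (hQ : ∀ S, Q S → ∀ x ∈ S, x ∈ elements L)
    (hR : Describes (signFamily L (2 ^ l)) R Q) :
    Describes (signFamily L (2 ^ l)) (stageStep pos l R I.item)
      (fun S' => S' ∈ Pb.solutions I ∧ ∃ S, Q S ∧ l ≤ (symmDiff S S').card) := by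
  refine describes_stageStep hpos hI hL fun S' hS' => ?_
  constructor
  · rintro ⟨S, hS, hd⟩
    obtain ⟨a, ha, h⟩ := exists_mem_signFamily L l S S' (hQ S hS) (subset_elements hI hL hS') hd
    exact ⟨a, ha, _, (hR _ _ _).2 ⟨ha, S, hS, rfl, rfl⟩, (le_dist_iff _ _ _).2 h⟩
  · rintro ⟨a, -, ⟨u, v⟩, hp, hd⟩
    obtain ⟨-, S, hS, rfl, rfl⟩ := (hR _ _ _).1 hp
    refine ⟨S, hS, ?_⟩
    exact_mod_cast ((le_dist_iff _ _ _).1 hd).trans (le_card_symmDiff S S' a)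

/-- There is a diverse sequence of solutions that ends with `S`. -/
def DiverseEnd (Pb : Problem) (l : ℕ) {t : ℕ} (I : Fin (t + 1) → Inst) (S : Finset Data) : Prop :=
  ∃ T : Fin (t + 1) → Finset Data, T (Fin.last t) = S ∧ (∀ i, T i ∈ Pb.solutions (I i)) ∧
    ∀ i j : Fin (t + 1), (j : ℕ) = i + 1 → l ≤ (symmDiff (T i) (T j)).card

theorem diverseEnd_succ {t : ℕ} (I : Fin (t + 2) → Inst) (S' : Finset Data) :
    DiverseEnd Pb l I S' ↔ S' ∈ Pb.solutions (I (Fin.last (t + 1))) ∧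
      ∃ S, DiverseEnd Pb l (fun i => I i.castSucc) S ∧ l ≤ (symmDiff S S').card := by
  constructor
  · rintro ⟨T, rfl, h1, h2⟩
    exact ⟨h1 _, T (Fin.last t).castSucc, ⟨fun i => T i.castSucc, rfl, fun i => h1 _,
      fun i j hij => h2 _ _ (by simpa using hij)⟩, h2 _ _ (by simp)⟩
  · rintro ⟨hS', S, ⟨T, rfl, h1, h2⟩, hd⟩
    refine ⟨Fin.snoc (α := fun _ => Finset Data) T S', by simp, fun i => ?_, fun i j hij => ?_⟩
    · refine Fin.lastCases ?_ (fun i => ?_) i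
      · simpa using hS'
      · simpa using h1 i
    · obtain ⟨i, rfl⟩ : ∃ i' : Fin (t + 1), i = i'.castSucc :=
        ⟨⟨i, by have := j.isLt; omega⟩, rfl⟩
      revert hij
      refine Fin.lastCases (fun hij => ?_) (fun j hij => ?_) j
      · have : i = Fin.last t := by
          ext; simpa using hij.symm
        subst this
        simpa using hd
      · simpa using h2 i j (by simpa using hij)

theorem describes_foldl (hpos : ∀ k, k ∈ pos ↔ k ∈ allKeys L (2 ^ l) ∧ k.Solvable Pb) (t : ℕ)
    (I : Fin (t + 1) → Inst) (hI : ∀ i, I i ∈ Pb.instances) (hL : ∀ i, (I i).item ∈ L) :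
    Describes (signFamily L (2 ^ l))
      ((List.ofFn fun i => (I i).item).foldl (stageStep pos l) (startStates L (2 ^ l) l))
      (DiverseEnd Pb l I) := by
  induction t with
  | zero =>
    have h := describes_first hpos (hI 0) (hL 0)
    have hE : DiverseEnd Pb l I = fun S' => S' ∈ Pb.solutions (I 0) := by
      funext S'
      rw [eq_iff_iff]
      constructor
      · rintro ⟨T, rfl, h1, -⟩; exact h1 0
      · intro hS
        refine ⟨fun _ => S', rfl, fun i => ?_, fun i j hij => ?_⟩
        · rw [Fin.fin_one_eq_zero i]; exact hS
        · omega
    rw [hE]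
    simpa using h
  | succ t ih =>
    have h := ih (fun i => I i.castSucc) (fun i => hI _) fun i => hL _
    have h2 := describes_next hpos (hI (Fin.last (t + 1))) (hL _) (fun S hS => by
      obtain ⟨T, rfl, h1, -⟩ := hS
      exact subset_elements (hI _) (hL _) (h1 (Fin.last t))) h
    rw [List.ofFn_succ', List.concat_eq_append, List.foldl_append]
    have hE : DiverseEnd Pb l I = _ := funext fun S' => propext (diverseEnd_succ I S')
    rw [hE]
    exact h2

end

/-- The dynamic program is correct if `pos` lists exactly the solvable ones among the colored instances. -/
theorem decideDiverse_iff {Pb : Problem} {l τ : ℕ} {pos : List Key} (hτ : 0 < τ)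
    (I : Fin τ → Inst) (hI : ∀ i, I i ∈ Pb.instances)
    (hpos : ∀ k, k ∈ pos ↔ k ∈ allKeys (List.ofFn fun i => (I i).item) (2 ^ l) ∧ k.Solvable Pb) :
    decideDiverse pos (List.ofFn fun i => (I i).item) (2 ^ l) l = true ↔ IsDiverseYes Pb I l := by
  obtain ⟨t, rfl⟩ : ∃ t, τ = t + 1 := ⟨τ - 1, by omega⟩
  have h := describes_foldl hpos t I hI fun i => List.mem_ofFn.2 ⟨i, rfl⟩
  rw [decideDiverse, Bool.not_eq_true', List.isEmpty_eq_false_iff]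
  constructor
  · intro hne
    obtain ⟨⟨b, u, v⟩, hm⟩ := List.exists_mem_of_ne_nil _ hne
    obtain ⟨-, S, ⟨T, -, h1, h2⟩, -⟩ := (h b u v).1 hm
    exact ⟨T, h1, h2⟩
  · rintro ⟨T, h1, h2⟩
    obtain ⟨b, hb⟩ := List.exists_mem_of_ne_nil _
      (signFamily_ne_nil (List.ofFn fun i => (I i).item) (2 ^ l))
    exact List.ne_nil_of_mem ((h b _ _).2 ⟨hb, _, ⟨T, rfl, h1, h2⟩, rfl, rfl⟩)

/-! ### Randomized computations -/

/-- On input `x` the program `P` makes at most `T` steps, its output always satisfies `S`, and it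
violates `G` with probability at most `ε`. -/
def MC (P : Prog) (x : Data) (S G : Data → Prop) (ε : ℝ≥0∞) (T : ℝ≥0) : Prop :=
  ∃ μ : PMF (Data × ℕ), Run P x μ ∧ (∀ a ∈ μ.support, (a.2 : ℝ≥0) ≤ T ∧ S a.1) ∧
    μ.toOuterMeasure {a | ¬ G a.1} ≤ ε

theorem toOuterMeasure_add_compl {Ω : Type} (μ : PMF Ω) (s : Set Ω) :
    μ.toOuterMeasure s + μ.toOuterMeasure sᶜ = 1 := by
  rw [PMF.toOuterMeasure_apply, PMF.toOuterMeasure_apply, ← ENNReal.tsum_add, ← μ.tsum_coe]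
  exact tsum_congr fun a => Set.indicator_self_add_compl_apply s μ a

theorem toOuterMeasure_le_one {Ω : Type} (μ : PMF Ω) (s : Set Ω) : μ.toOuterMeasure s ≤ 1 :=
  le_self_add.trans (toOuterMeasure_add_compl μ s).le

theorem MonteCarlo.mc {P : Prog} {x : Data} {G : Data → Prop} {p : ℝ} {T : ℝ≥0}
    (h : MonteCarlo P x G p T) : MC P x (fun _ => True) G (ENNReal.ofReal p) T := by
  obtain ⟨μ, hr, ht, hp⟩ := h
  refine ⟨μ, hr, fun a ha => ⟨ht a ha, trivial⟩, ?_⟩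
  have h1 := toOuterMeasure_add_compl μ {a | G a.1}
  have h2 : μ.toOuterMeasure {a | G a.1} ≠ ∞ :=
    ((toOuterMeasure_le_one μ _).trans_lt ENNReal.one_lt_top).ne
  have h3 : μ.toOuterMeasure {a | G a.1}ᶜ ≠ ∞ :=
    ((toOuterMeasure_le_one μ _).trans_lt ENNReal.one_lt_top).ne
  change μ.toOuterMeasure {a | G a.1}ᶜ ≤ _
  rw [ENNReal.le_ofReal_iff_toReal_le h3]
  · have h4 := congrArg ENNReal.toReal h1
    rw [ENNReal.toReal_add h2 h3, ENNReal.toReal_one] at h4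
    linarith
  · show 0 ≤ p
    have : (μ.toOuterMeasure {a | G a.1}).toReal ≤ 1 :=
      ENNReal.toReal_le_of_le_ofReal (by norm_num) (by simpa using toOuterMeasure_le_one μ _)
    linarith

theorem MC.monteCarlo {P : Prog} {x : Data} {S G : Data → Prop} {p : ℝ} {T : ℝ≥0} (hp : 0 ≤ p)
    (h : MC P x S G (ENNReal.ofReal p) T) : MonteCarlo P x G p T := by
  obtain ⟨μ, hr, ht, hμ⟩ := h
  refine ⟨μ, hr, fun a ha => (ht a ha).1, ?_⟩
  have h1 := toOuterMeasure_add_compl μ {a | G a.1}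
  have h2 : μ.toOuterMeasure {a | G a.1} ≠ ∞ :=
    ((toOuterMeasure_le_one μ _).trans_lt ENNReal.one_lt_top).ne
  have h3 : μ.toOuterMeasure {a | G a.1}ᶜ ≠ ∞ :=
    ((toOuterMeasure_le_one μ _).trans_lt ENNReal.one_lt_top).ne
  have h4 := congrArg ENNReal.toReal h1
  rw [ENNReal.toReal_add h2 h3, ENNReal.toReal_one] at h4
  have h5 : (μ.toOuterMeasure {a | G a.1}ᶜ).toReal ≤ p := ENNReal.toReal_le_of_le_ofReal hp hμ
  linarith

namespace MC

variable {P Q c p q : Prog} {x y z : Data} {S G S' G' : Data → Prop} {ε ε' : ℝ≥0∞} {T T' : ℝ≥0}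

theorem mono (h : MC P x S G ε T) (hS : ∀ y, S y → S' y) (hG : ∀ y, G y → G' y) (hε : ε ≤ ε')
    (hT : T ≤ T') : MC P x S' G' ε' T' := by
  obtain ⟨μ, hr, ht, hμ⟩ := h
  refine ⟨μ, hr, fun a ha => ⟨(ht a ha).1.trans hT, hS _ (ht a ha).2⟩, le_trans ?_ (hμ.trans hε)⟩
  exact MeasureTheory.OuterMeasure.mono _ fun a ha h => ha (hG _ h)

theorem of_det {t : ℕ} (h : Det P x y t) (hS : S y) (hG : G y) : MC P x S G 0 t := by
  obtain ⟨k, hk, hr⟩ := h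
  refine ⟨_, hr, fun a ha => ?_, ?_⟩
  · rw [PMF.support_pure, Set.mem_singleton_iff] at ha
    subst ha
    exact ⟨by exact_mod_cast hk, hS⟩
  · rw [PMF.toOuterMeasure_pure_apply, if_neg (by simpa using hG)]

/-- Outputs and step counts may be changed by a deterministic function. -/
theorem of_map {μ : PMF (Data × ℕ)} {φ : Data × ℕ → Data × ℕ} {k : ℕ}
    (hr : Run Q y (μ.map φ)) (ht : ∀ a ∈ μ.support, (a.2 : ℝ≥0) ≤ T ∧ S a.1)
    (hμ : μ.toOuterMeasure {a | ¬ G a.1} ≤ ε) (hk : ∀ a, (φ a).2 ≤ a.2 + k)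
    (hS : ∀ a, S a.1 → S' (φ a).1) (hG : ∀ a, G a.1 → G' (φ a).1) : MC Q y S' G' ε (T + k) := by
  refine ⟨_, hr, fun a ha => ?_, le_trans ?_ hμ⟩
  · rw [PMF.mem_support_map_iff] at ha
    obtain ⟨b, hb, rfl⟩ := ha
    refine ⟨?_, hS _ (ht b hb).2⟩
    calc (((φ b).2 : ℕ) : ℝ≥0) ≤ ((b.2 + k : ℕ) : ℝ≥0) := by exact_mod_cast hk b
      _ ≤ T + k := by push_cast; gcongr; exact (ht b hb).1
  · rw [PMF.toOuterMeasure_map_apply]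
    exact MeasureTheory.OuterMeasure.mono _ fun a ha h => ha (hG _ h)

theorem ite_true {t : ℕ} (hc : Det c x y t) (hy : y ≠ .nil) (hp : MC p x S G ε T) :
    MC (.ite c p q) x S G ε (T + (t + 1 : ℕ)) := by
  obtain ⟨k, hk, hc⟩ := hc
  obtain ⟨μ, hr, ht, hμ⟩ := hp
  have h := Run.ite (q := q) (ν := fun _ => μ) hc (fun _ _ _ => hr) (by simp [hy])
  rw [PMF.pure_bind] at h
  exact of_map h ht hμ (fun a => by simp only; omega) (fun _ h => h) (fun _ h => h)

theorem loop (h : MC (.ite c (.seq p (.loop c p)) .ident) x S G ε T) :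
    MC (.loop c p) x S G ε T :=
  let ⟨μ, hr, h⟩ := h
  ⟨μ, .loop hr, h⟩

theorem cons {t : ℕ} (hP : MC P x S G ε T) (hQ : Det Q x z t) :
    MC (.cons P Q) x (fun d => ∃ u, S u ∧ d = .cons u z) (fun d => ∃ u, G u ∧ d = .cons u z) ε
      (T + (t + 1 : ℕ)) := by
  obtain ⟨k, hk, hQ⟩ := hQ
  obtain ⟨μ, hr, ht, hμ⟩ := hP
  have h := Run.cons hr hQ
  simp only [PMF.pure_map] at h
  exact of_map (φ := fun a => (Data.cons a.1 z, a.2 + k + 1)) h ht hμ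
    (fun a => by simp only; omega) (fun a h => ⟨_, h, rfl⟩) (fun a h => ⟨_, h, rfl⟩)

/-- Error probabilities add up. -/
theorem seq (hP : MC P x S G ε T) (hQ : ∀ y, S y → MC Q y S' (fun z => G y → G' z) ε' T') :
    MC (.seq P Q) x S' G' (ε + ε') (T + T' + 1) := by
  classical
  obtain ⟨μ, hr, ht, hμ⟩ := hP
  have hQ' : ∀ y, ∃ ν : PMF (Data × ℕ), S y → Run Q y ν ∧
      (∀ a ∈ ν.support, (a.2 : ℝ≥0) ≤ T' ∧ S' a.1) ∧
      ν.toOuterMeasure {a | ¬ (G y → G' a.1)} ≤ ε' := by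
    intro y
    by_cases h : S y
    · obtain ⟨ν, h⟩ := hQ y h
      exact ⟨ν, fun _ => h⟩
    · exact ⟨PMF.pure (y, 0), fun h' => absurd h' h⟩
  choose ν hν using hQ'
  refine ⟨_, .seq hr fun a ha => (hν a.1 (ht a ha).2).1, fun b hb => ?_, ?_⟩
  · rw [PMF.mem_support_bind_iff] at hb
    obtain ⟨a, ha, hb⟩ := hb
    rw [PMF.mem_support_map_iff] at hb
    obtain ⟨d, hd, rfl⟩ := hb
    have h1 := (hν a.1 (ht a ha).2).2.1 d hd
    refine ⟨?_, h1.2⟩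
    push_cast
    gcongr
    · exact (ht a ha).1
    · exact h1.1
  · rw [PMF.toOuterMeasure_bind_apply]
    have hterm : ∀ a, μ a * ((ν a.1).map fun b => (b.1, a.2 + b.2 + 1)).toOuterMeasure
        {b | ¬ G' b.1} ≤ Set.indicator {a : Data × ℕ | ¬ G a.1} μ a + μ a * ε' := by
      intro a
      by_cases ha : a ∈ μ.support
      · rw [PMF.toOuterMeasure_map_apply]
        by_cases hG : G a.1
        · refine le_trans (mul_le_mul_right ?_ (μ a)) le_add_self
          refine le_trans (MeasureTheory.OuterMeasure.mono _ ?_) (hν a.1 (ht a ha).2).2.2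
          intro b hb h
          exact hb (h hG)
        · refine le_trans ?_ le_self_add
          rw [Set.indicator_of_mem (by exact hG)]
          exact (mul_le_mul_right (toOuterMeasure_le_one _ _) _).trans (mul_one _).le
      · rw [PMF.mem_support_iff, not_not] at ha
        rw [ha]; simp
    refine (ENNReal.tsum_le_tsum hterm).trans ?_
    rw [ENNReal.tsum_add, ENNReal.tsum_mul_right, μ.tsum_coe, one_mul]
    rw [PMF.toOuterMeasure_apply] at hμ
    gcongr

end MC

/-! ### Solving a list of colored instances -/

/-- Writes the current key and the error code into an input of the algorithm for colored
instances and keeps the state. The state consists of the remaining keys, the keys found solvable,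
the error code, and further data. -/
def callProg (A code : Prog) : Prog :=
  .cons (.seq (.cons (.seq (.seq .head .head) code) (.seq .tail (.seq .tail .head))) A) .ident

/-- Removes the current key from the list, and adds it to the solvable ones if the answer is not
`nil`. -/
def recordProg : Prog :=
  .ite .head
    (.cons (.seq .tail (.seq .head .tail))
      (.cons (.cons (.seq .tail (.seq .head .head)) (.seq .tail (.seq .tail .head)))
        (.seq .tail (.seq .tail .tail))))
    (.cons (.seq .tail (.seq .head .tail)) (.seq .tail .tail))

/-- Applies the algorithm `A` to all keys. -/
def callAllProg (A code : Prog) : Prog := .loop .head (.seq (callProg A code) recordProg)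

theorem det_recordProg (out : Data) (k : Key) (K acc : List Key) (e aux : Data) :
    Det recordProg (.cons out (enc (k :: K, acc, e, aux)))
      (if out = .nil then enc (K, acc, e, aux) else enc (K, k :: acc, e, aux)) 40 := by
  set x : Data := .cons out (enc (k :: K, acc, e, aux)) with hx
  by_cases h : out = .nil
  · rw [if_pos h]
    have h1 : Det .head x .nil 1 := h ▸ Det.head x
    exact (h1.ite_false (((Det.tail x).seq ((Det.head _).seq (Det.tail _))).cons
      ((Det.tail x).seq (Det.tail _)))).mono (by norm_num)
  · rw [if_neg h]
    exact ((Det.head x).ite_true h (((Det.tail x).seq ((Det.head _).seq (Det.tail _))).cons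
      ((((Det.tail x).seq ((Det.head _).seq (Det.head _))).cons
        ((Det.tail x).seq ((Det.tail _).seq (Det.head _)))).cons
        ((Det.tail x).seq ((Det.tail _).seq (Det.tail _)))))).mono (by norm_num)

/-- With an error of at most `q` per call, the keys found solvable are the right ones up to the error
`K.length * q`. Whatever the calls answer, a sublist of the keys is found, so that the time bounds of
the later parts hold in all cases. -/
theorem mc_callAllProg {A code : Prog} {e aux : Data} {good : Key → Prop} [DecidablePred good]
    {q : ℝ≥0∞} {T : ℝ≥0} {t : ℕ} (K : List Key) (acc : List Key)
    (hcode : ∀ k ∈ K, Det code (enc k) k.code t)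
    (hA : ∀ k ∈ K, MC A (.cons k.code e) (fun _ => True) (fun out => out ≠ .nil ↔ good k) q T) :
    MC (callAllProg A code) (enc (K, acc, e, aux))
      (fun d => ∃ K' : List Key, K'.Sublist K ∧ d = enc (([] : List Key), K'.reverse ++ acc, e, aux))
      (fun d => d = enc (([] : List Key), (K.filter fun k => decide (good k)).reverse ++ acc, e, aux))
      (K.length * q) (K.length * (T + t + 80) + 5) := by
  induction K generalizing acc with
  | nil =>
    have h : Det (callAllProg A code) (enc (([] : List Key), acc, e, aux))
        (enc (([] : List Key), acc, e, aux)) 3 := .loop ((Det.head _).ite_false (Det.ident _))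
    refine (MC.of_det (S := fun d => d = _) (G := fun d => d = _) h rfl rfl).mono ?_ ?_ (by simp) ?_
    · rintro _ rfl; exact ⟨[], by simp⟩
    · rintro _ rfl; simp
    · simp; norm_num
  | cons k K ih =>
    set x : Data := enc (k :: K, acc, e, aux) with hx
    have hq : Det (.cons (.seq (.seq .head .head) code) (.seq .tail (.seq .tail .head))) x
        (.cons k.code e) (t + 10) :=
      ((((Det.head x).seq (Det.head _)).seq (hcode k (by simp))).cons
        ((Det.tail x).seq ((Det.tail _).seq (Det.head _)))).mono (by omega)
    have hcall := ((MC.of_det (S := fun d => d = .cons k.code e) (G := fun _ => True) hq rfl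
      trivial).seq (Q := A) (S' := fun _ => True) (G' := fun out => out ≠ .nil ↔ good k) (ε' := q)
      (T' := T) (by
        rintro _ rfl
        exact (hA k (by simp)).mono (fun _ h => h) (fun _ h _ => h) le_rfl le_rfl)).cons
      (Det.ident x)
    have hbody := hcall.seq (Q := recordProg) (ε' := 0) (T' := 40)
      (S' := fun d => d = enc (K, acc, e, aux) ∨ d = enc (K, k :: acc, e, aux))
      (G' := fun d => d = if good k then enc (K, k :: acc, e, aux) else enc (K, acc, e, aux)) (by
        rintro _ ⟨u, -, rfl⟩
        refine MC.of_det (det_recordProg u k K acc e aux) ?_ ?_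
        · split <;> simp
        · rintro ⟨u', hu', heq⟩
          obtain rfl : u = u' := by injection heq
          by_cases hg : good k
          · rw [if_pos hg, if_neg (hu'.2 hg)]
          · rw [if_neg hg, if_pos (by by_contra h; exact hg (hu'.1 h))])
    have hih := fun acc => ih acc (fun k hk => hcode k (List.mem_cons_of_mem _ hk))
      (fun k hk => hA k (List.mem_cons_of_mem _ hk))
    have hall := hbody.seq (Q := callAllProg A code) (ε' := K.length * q)
      (T' := K.length * (T + t + 80) + 5)
      (S' := fun d => ∃ K' : List Key, K'.Sublist (k :: K) ∧
        d = enc (([] : List Key), K'.reverse ++ acc, e, aux))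
      (G' := fun d => d = enc (([] : List Key),
        ((k :: K).filter fun k => decide (good k)).reverse ++ acc, e, aux)) (by
        rintro _ (rfl | rfl)
        · refine (hih acc).mono ?_ ?_ le_rfl le_rfl
          · rintro _ ⟨K', hK', rfl⟩
            exact ⟨K', hK'.cons k, rfl⟩
          · rintro _ rfl h
            by_cases hg : good k
            · rw [if_pos hg] at h
              have := inj h
              simp at this
            · rw [List.filter_cons, if_neg (by simpa using hg)]
        · refine (hih (k :: acc)).mono ?_ ?_ le_rfl le_rfl
          · rintro _ ⟨K', hK', rfl⟩
            exact ⟨k :: K', hK'.cons_cons k, by simp⟩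
          · rintro _ rfl h
            by_cases hg : good k
            · rw [List.filter_cons, if_pos (by simpa using hg)]; simp
            · rw [if_neg hg] at h
              have := inj h
              simp at this)
    refine (MC.loop (MC.ite_true (Det.head x) (by simp [hx, Data.head]) hall)).mono
      (fun _ h => h) (fun _ h => h) ?_ ?_
    · rw [List.length_cons]; push_cast
      rw [zero_add, add_zero, add_mul, one_mul, add_comm]
    · rw [List.length_cons]; push_cast
      have : ((t : ℝ≥0) + 10 + T + 1 + 2 + 40 + 1 + (K.length * (T + t + 80) + 5) + 1 + 2)
        ≤ (K.length + 1) * (T + t + 80) + 5 := by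
        rw [← NNReal.coe_le_coe]; push_cast; linarith
      exact this

/-! ### Error codes -/

theorem errorCode_half_pow (j : ℕ) : errorCode ((1 / 2) ^ j) = .cons .nil (enc j) := by
  have h : Real.logb 2 (1 / (1 / 2) ^ j) = j := by
    rw [one_div, ← inv_pow, one_div, inv_inv, Real.logb_pow, Real.logb_self_eq_one (by norm_num),
      mul_one]
  rw [errorCode, if_neg (by positivity), h, Nat.ceil_natCast]; rfl

/-- The number in the code of `p` determines `p` up to a factor of two. -/
theorem exists_errorCode_eq {p : ℝ} (hp : 0 < p) : ∃ k : ℕ,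
    errorCode p = .cons .nil (enc k) ∧ (1 / 2) ^ k ≤ p ∧ (p ≤ 1 → p ≤ 2 * (1 / 2) ^ k) := by
  refine ⟨⌈Real.logb 2 (1 / p)⌉₊, by rw [errorCode, if_neg hp.ne']; rfl, ?_, fun hp1 => ?_⟩
  · have h1 := Nat.le_ceil (Real.logb 2 (1 / p))
    rw [Real.logb_le_iff_le_rpow (by norm_num) (by positivity), Real.rpow_natCast] at h1
    rw [div_pow, one_pow, div_le_iff₀ (by positivity)]
    rw [div_le_iff₀ hp] at h1
    linarith
  · have h0 : 0 ≤ Real.logb 2 (1 / p) :=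
      Real.logb_nonneg (by norm_num) (by rw [le_div_iff₀ hp]; linarith)
    have h1 := (Nat.ceil_lt_add_one h0).le
    rw [← sub_le_iff_le_add, Real.le_logb_iff_rpow_le (by norm_num) (by positivity),
      Real.rpow_sub (by norm_num), Real.rpow_natCast, Real.rpow_one] at h1
    rw [div_pow, one_pow]
    rw [div_le_div_iff₀ (by norm_num) hp] at h1
    rw [mul_one_div, le_div_iff₀ (by positivity)]
    linarith

/-- Lowers the error bound: the input is a number `m` and an error code. -/
def lowerProg : Prog :=
  .ite .tail (.seq (.loop .head (.cons (.seq .head .tail) (.cons .nil .tail))) .tail) .nil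

theorem det_lowerLoop (m : ℕ) : ∀ k : ℕ,
    Det (.loop .head (.cons (.seq .head .tail) (.cons .nil .tail))) (.cons (enc m) (enc k))
      (.cons .nil (enc (k + m))) (m * 11 + 3) := by
  induction m with
  | zero => exact fun k => .loop ((Det.head _).ite_false (Det.ident _))
  | succ m ih =>
    intro k
    set x : Data := .cons (enc (m + 1)) (enc k)
    have h2 := ih (k + 1)
    rw [show k + 1 + m = k + (m + 1) by ring] at h2
    refine .loop (.mono (.ite_true (Det.head x) (by simp [x, Data.head]) (.seq (.cons
      ((Det.head x).seq (Det.tail _)) ((Det.nil x).cons (Det.tail x))) h2)) (by omega))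

/-- The lowered error bound `q` is `p * 2 ^ (-m)` up to a factor of two. -/
theorem exists_lower (m : ℕ) {p : ℝ} (hp : 0 ≤ p) (hp1 : p ≤ 1) : ∃ q : ℝ, 0 ≤ q ∧ q ≤ 1 ∧
    2 ^ m * q ≤ p ∧ p ≤ 2 * 2 ^ m * q ∧
      Det lowerProg (.cons (enc m) (errorCode p)) (errorCode q) (m * 11 + 20) := by
  rcases hp.eq_or_lt with rfl | hpos
  · refine ⟨0, le_rfl, zero_le_one, by simp, by simp, ?_⟩
    have h0 : errorCode 0 = .nil := by rw [errorCode, if_pos rfl]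
    rw [h0]
    exact ((Det.tail _).ite_false (Det.nil _)).mono (by omega)
  · obtain ⟨k, hk, h1, h2⟩ := exists_errorCode_eq hpos
    have h3 : (2 : ℝ) ^ m * (1 / 2) ^ (k + m) = (1 / 2) ^ k := by
      rw [pow_add, mul_comm ((1 / 2 : ℝ) ^ k), ← mul_assoc, ← mul_pow]; norm_num
    refine ⟨(1 / 2) ^ (k + m), by positivity, pow_le_one₀ (by norm_num) (by norm_num),
      by rw [h3]; exact h1, by rw [mul_assoc, h3]; exact h2 hp1, ?_⟩
    rw [hk, errorCode_half_pow]
    have h4 := det_lowerLoop m (k + 1)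
    rw [show k + 1 + m = (k + m) + 1 by ring] at h4
    exact ((Det.tail _).ite_true (by simp [Data.tail]) (h4.seq (Det.tail _))).mono (by omega)

/-! ### Every run takes at least one step -/

theorem Run.one_le {P : Prog} {x : Data} {μ : PMF (Data × ℕ)} (h : Run P x μ) :
    ∀ a ∈ μ.support, 1 ≤ a.2 := by
  induction h with
  | ident | nil | head | tail => simp
  | flip =>
    intro a ha
    obtain ⟨b, -, rfl⟩ := (PMF.mem_support_map_iff _ _ _).1 ha
    exact le_rfl
  | cons =>
    intro a ha
    obtain ⟨b, -, hb⟩ := (PMF.mem_support_bind_iff _ _ _).1 ha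
    obtain ⟨d, -, rfl⟩ := (PMF.mem_support_map_iff _ _ _).1 hb
    exact Nat.le_add_left _ _
  | seq =>
    intro a ha
    obtain ⟨b, -, hb⟩ := (PMF.mem_support_bind_iff _ _ _).1 ha
    obtain ⟨d, -, rfl⟩ := (PMF.mem_support_map_iff _ _ _).1 hb
    exact Nat.le_add_left _ _
  | ite =>
    intro a ha
    obtain ⟨b, -, hb⟩ := (PMF.mem_support_bind_iff _ _ _).1 ha
    obtain ⟨d, -, rfl⟩ := (PMF.mem_support_map_iff _ _ _).1 hb
    exact Nat.le_add_left _ _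
  | loop _ ih => exact ih

theorem MonteCarlo.one_le {P : Prog} {x : Data} {G : Data → Prop} {p : ℝ} {T : ℝ≥0}
    (h : MonteCarlo P x G p T) : 1 ≤ T := by
  obtain ⟨μ, hr, ht, -⟩ := h
  obtain ⟨a, ha⟩ := μ.support_nonempty
  calc (1 : ℝ≥0) ≤ (a.2 : ℝ≥0) := by exact_mod_cast hr.one_le a ha
    _ ≤ T := ht a ha

/-! ### Preparation of the colored instances -/

/-- The data available to the algorithm: the instance and the number `2 ^ l`. -/
abbrev Input : Type := (List Item × ℕ) × ℕ

/-- The number `2 ^ l`, computed by repeated doubling. This takes exponential time in `l`. -/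
theorem exists_powProg : ∃ (P : Prog) (t : Input → ℕ), PB t ∧
    ∀ L l, Det P (enc (L, l)) (enc ((L, l), 2 ^ l)) (t ((L, l), 2 ^ l)) := by
  obtain ⟨P, t, ⟨c, hc⟩, hP, -⟩ : PT (fun p : Data × ℕ × Data => p.2.1 + p.2.1) :=
    PT.snd.fst'.add PT.snd.fst'
  refine ⟨.cons .ident (.seq (.cons .tail (.cons .nil (constProg (enc 1))))
    (.seq (foldProg P) (.seq .tail .tail))),
    fun x => sz x * ((sz x + 6) ^ c + 30) + 20, ?_, fun L l => ?_⟩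
  · exact (PB.size.mul (((PB.size.add (.const 6)).pow c).add (.const 30))).add (.const 20)
  · have key : ∀ (m : List Data) (s : ℕ),
        m.foldl (fun s _ => s + s) s = s * 2 ^ m.length := by
      intro m
      induction m with
      | nil => simp
      | cons a m ih => intro s; rw [List.foldl_cons, ih, List.length_cons, pow_succ]; ring
    have h1 : sz ((L, l), 2 ^ l) = sz L + (2 * l + 1) + 1 + (2 * 2 ^ l + 1) + 1 := by simp
    have hfold := det_foldProg (P := P) (step := fun p : Data × ℕ × Data => p.2.1 + p.2.1)
      (a := Data.nil) (T := (sz ((L, l), 2 ^ l) + 6) ^ c) (List.replicate l Data.nil) 1 (by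
        intro l' b hb
        refine (hP _).mono ((hc _).trans (Nat.pow_le_pow_left ?_ c))
        have hb' : b = Data.nil := List.eq_of_mem_replicate (hb.subset (by simp))
        have hlen := hb.length_le
        simp only [List.length_append, List.length_singleton, List.length_replicate] at hlen
        have h2 : 2 ^ l'.length ≤ 2 ^ l := Nat.pow_le_pow_right (by norm_num) (by omega)
        have h3 : sz Data.nil = 1 := rfl
        rw [sz_pair, sz_pair, sz_nat, key, hb', h3, h1, one_mul]
        omega)
    rw [key, one_mul, List.length_replicate, enc_pair, PT.enc_replicate] at hfold
    set x : Data := enc (L, l)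
    refine (Det.cons (Det.ident x) (Det.seq ((Det.tail x).cons ((Det.nil x).cons
      (det_constProg (enc 1) x))) (hfold.seq ((Det.tail _).seq (Det.tail _))))).mono ?_
    have h4 : (enc 1).size = 3 := rfl
    have h5 : l * ((sz ((L, l), 2 ^ l) + 6) ^ c + 30) ≤
        sz ((L, l), 2 ^ l) * ((sz ((L, l), 2 ^ l) + 6) ^ c + 30) :=
      Nat.mul_le_mul_right _ (by omega)
    beta_reduce
    omega

/-- The colored instances, a bound for the logarithm of their number, and the original input. -/
def prepare (x : Input) : List Key × ℕ × Input :=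
  (allKeys x.1.1 x.2, logBound (allKeys x.1.1 x.2).length, x)

theorem PT.prepare : PT prepare := by
  have h : PT (fun x : Input => DiverseMultistage.allKeys x.1.1 x.2) := fst.fst'.allKeys snd
  exact h.pair (h.length.logBound.pair id)

/-- Brings the output of the preparation and the error code into the form of a state. -/
def arrangeProg : Prog :=
  .cons (.seq .head .head) (.cons .nil (.cons
    (.seq (.cons (.seq .head (.seq .tail .head)) .tail) lowerProg)
    (.seq .head (.seq .tail .tail))))

theorem det_arrangeProg {K : List Key} {m t : ℕ} {x : Input} {e e' : Data}
    (h : Det lowerProg (.cons (enc m) e) e' t) :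
    Det arrangeProg (.cons (enc (K, m, x)) e) (enc (K, ([] : List Key), e', enc x)) (t + 40) := by
  set y : Data := .cons (enc (K, m, x)) e
  exact (((Det.head y).seq (Det.head _)).cons ((Det.nil y).cons
    (((((Det.head y).seq ((Det.tail _).seq (Det.head _))).cons (Det.tail y)).seq h).cons
      ((Det.head y).seq ((Det.tail _).seq (Det.tail _)))))).mono (by omega)

theorem allKeys_ne_nil {L : List Item} (hL : L ≠ []) (b : ℕ) : allKeys L b ≠ [] := by
  obtain ⟨x, hx⟩ := List.exists_mem_of_ne_nil _ hL
  obtain ⟨a, ha⟩ := List.exists_mem_of_ne_nil _ (signFamily_ne_nil L b)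
  refine List.ne_nil_of_mem (a := (x, (a, a), (0, 0), (0, 0))) ?_
  simp only [allKeys, List.mem_product, mem_below]
  exact ⟨hx, ⟨ha, ha⟩, ⟨by omega, by omega⟩, by omega, by omega⟩

theorem isColoredAnswer_iff {Pb : Problem} {I : Inst} {c : Data → Fin 4} {n : Fin 4 → ℕ} {out : Data}
    (h : IsColoredAnswer Pb I c n out) : out ≠ .nil ↔ ∃ S, IsColoredSolution Pb I c n S := by
  rcases h with ⟨L, -, hL, rfl⟩ | ⟨h, rfl⟩
  · exact ⟨fun _ => ⟨_, hL⟩, fun _ => by simp⟩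
  · exact ⟨fun h => absurd rfl h, fun h' => absurd h' h⟩

theorem multistageCode_eq {τ : ℕ} (I : Fin τ → Inst) (l : ℕ) :
    multistageCode I l = enc (List.ofFn fun i => (I i).item, l) := by
  rw [multistageCode, enc_pair]
  congr 1
  change _ = Data.ofList (List.map enc (List.ofFn _))
  rw [List.map_ofFn]
  congr 2
  funext i
  exact (Inst.enc_item (I i)).symm

/-- Polynomial bounds in `n` and `2 ^ l`. -/
theorem PB.le_pow {t : Input → ℕ} (ht : PB t) : ∃ C : ℕ, ∀ L l,
    t ((L, l), 2 ^ l) ≤ 2 ^ (C * l) * sz (L, l) ^ (3 * C) := by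
  obtain ⟨C, hC⟩ := ht
  refine ⟨C, fun L l => (hC _).trans ?_⟩
  rw [mul_comm C l, pow_mul 2 l C, pow_mul, ← mul_pow]
  refine Nat.pow_le_pow_left ?_ C
  have h1 : 3 ≤ sz (L, l) := by
    have := sz_pos L
    rw [sz_pair, sz_nat]; omega
  have h2 : 1 ≤ 2 ^ l := Nat.one_le_two_pow
  rw [sz_pair (L, l), sz_nat]
  generalize sz (L, l) = n at *
  generalize 2 ^ l = y at *
  have h3 : n * 9 ≤ n ^ 3 := by
    calc n * 9 = n * (3 * 3) := by ring
      _ ≤ n * (n * n) := by gcongr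
      _ = n ^ 3 := by ring
  nlinarith [Nat.mul_le_mul_left y h3, Nat.mul_le_mul h2 h1]

/-! ### The reduction -/

/-- The whole algorithm: doubling, preparation, calls of `A`, and the dynamic program. -/
def mainProg (pow prep code dp A : Prog) : Prog :=
  .seq (.seq (.cons (.seq .head (.seq pow prep)) .tail) arrangeProg)
    (.seq (callAllProg A code) (.seq (.cons (.seq .tail (.seq .tail .tail)) (.seq .tail .head)) dp))

/-- The list of the colored instances of an input. -/
abbrev Input.keys (x : Input) : List Key := allKeys x.1.1 x.2

theorem fst_mem_of_mem_allKeys {L : List Item} {b : ℕ} {k : Key} (h : k ∈ allKeys L b) :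
    k.1 ∈ L := by
  obtain ⟨x, k⟩ := k
  rw [allKeys, List.mem_product] at h
  exact h.1

/-- The reduction, with error probabilities and running times that are still expressed in terms of
the input and the running time `T` of a single call. -/
theorem exists_mainProg (A : Prog) : ∃ (M : Prog) (W B N : Input → ℕ), PB W ∧ PB B ∧ PB N ∧
    (∀ x, 2 * 2 ^ (logBound x.keys.length) ≤ N x) ∧
    (∀ x, ∀ k ∈ x.keys, k.code.size ≤ W x) ∧
    ∀ (Pb : Problem) (τ : ℕ) (I : Fin τ → Inst) (l : ℕ) (e e' : Data) (q : ℝ≥0∞) (T : ℝ≥0)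
      (x : Input), x = ((List.ofFn fun i => (I i).item, l), 2 ^ l) → 0 < τ →
      (∀ i, I i ∈ Pb.instances) →
      Det lowerProg (.cons (enc (logBound x.keys.length)) e) e' (logBound x.keys.length * 11 + 20) →
      (∀ k ∈ x.keys, MC A (.cons k.code e') (fun _ => True)
        (fun out => out ≠ .nil ↔ k.Solvable Pb) q T) →
      MC M (.cons (multistageCode I l) e) (fun _ => True) (IsDiverseAnswer Pb I l)
        (x.keys.length * q) (B x * (T + 1)) := by
  classical
  obtain ⟨pow, tpow, htpow, hpow⟩ := exists_powProg
  obtain ⟨prep, tprep, htprep, hprep, hsprep⟩ := PT.prepare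
  obtain ⟨code, tcode, ⟨ccode, hccode⟩, hcode, ⟨cW, hcW⟩⟩ :=
    (PT.id.keyCode : PT fun k : Key => k.code)
  obtain ⟨dp, tdp, ⟨cdp, hcdp⟩, hdp, -⟩ : PT (fun y : Input × List Key =>
      decideDiverse y.2 y.1.1.1 y.1.2 y.1.1.2) :=
    PT.decideDiverse PT.snd PT.fst.fst'.fst' PT.fst.snd' PT.fst.fst'.snd'
  have hkeys : PT (fun x : Input => x.keys) := PT.fst.fst'.allKeys PT.snd
  have hκ : PB (fun x : Input => sz x.keys) := hkeys.size
  refine ⟨mainProg pow prep code dp A, fun x => (sz x.keys + 1) ^ cW,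
    fun x => tpow x + tprep x + (11 * sz (prepare x) + 80) +
      (sz x.keys * ((sz x.keys + 1) ^ ccode + 80) + 5) + ((sz x + sz x.keys + 1 + 1) ^ cdp + 20),
    fun x => 4 * sz x.keys + 2, (hκ.add (.const 1)).pow cW, ?_,
    ((PB.const 4).mul hκ).add (.const 2), ?_, ?_, ?_⟩
  · exact (((htpow.add htprep).add (((PB.const 11).mul hsprep).add (.const 80))).add
      ((hκ.mul (((hκ.add (.const 1)).pow ccode).add (.const 80))).add (.const 5))).add
      (((((PB.size.add hκ).add (.const 1)).add (.const 1)).pow cdp).add (.const 20))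
  · intro x
    have h1 := (logBound_spec x.keys.length).2
    have h2 := length_le_sz x.keys
    beta_reduce
    omega
  · intro x k hk
    exact (hcW k).trans (Nat.pow_le_pow_left (by have := sz_le_of_mem hk; omega) _)
  · intro Pb τ I l e e' q T x hx hτ hI hlow hA
    set L : List Item := List.ofFn fun i => (I i).item with hL
    have hm : logBound x.keys.length ≤ sz (prepare x) := by
      have : sz (prepare x) = sz x.keys + (2 * logBound x.keys.length + 1 + sz x + 1) + 1 := by
        rw [prepare, sz_pair, sz_pair, sz_nat]
      omega
    set y : Data := .cons (multistageCode I l) e with hy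
    have hfirst : Det (.seq (.cons (.seq .head (.seq pow prep)) .tail) arrangeProg) y
        (enc (x.keys, ([] : List Key), e', enc x))
        (tpow x + tprep x + (11 * sz (prepare x) + 80)) := by
      have h1 : Det .head y (enc (L, l)) 1 := by
        rw [← multistageCode_eq]; exact Det.head y
      have h2 := hpow L l
      rw [← hx] at h2
      exact (((h1.seq (h2.seq (hprep x))).cons (Det.tail y)).seq (det_arrangeProg hlow)).mono
        (by omega)
    have hcall := mc_callAllProg (aux := enc x) (good := fun k => k.Solvable Pb) (T := T)
      (t := (sz x.keys + 1) ^ ccode) x.keys [] (code := code) (fun k hk =>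
        (hcode k).mono ((hccode k).trans
          (Nat.pow_le_pow_left (by have := sz_le_of_mem hk; omega) _))) hA
    have hlast := hcall.seq (Q := .seq (.cons (.seq .tail (.seq .tail .tail)) (.seq .tail .head)) dp)
      (S' := fun _ => True) (G' := IsDiverseAnswer Pb I l) (ε' := 0)
      (T' := ((sz x + sz x.keys + 1 + 1) ^ cdp + 12 : ℕ)) (by
        rintro _ ⟨K', hK', rfl⟩
        rw [List.append_nil]
        set z : Data := enc (([] : List Key), K'.reverse, e', enc x) with hz
        have h1 := hdp (x, K'.reverse)
        have h2 : tdp (x, K'.reverse) ≤ (sz x + sz x.keys + 1 + 1) ^ cdp := by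
          refine (hcdp _).trans (Nat.pow_le_pow_left ?_ _)
          have := sz_le_of_sublist hK'
          rw [sz_pair, sz_reverse]; omega
        refine (MC.of_det (S := fun _ => True) (((((Det.tail z).seq ((Det.tail _).seq
          (Det.tail _))).cons ((Det.tail z).seq (Det.head _))).seq h1).mono (by omega)) trivial
          (fun heq => ?_))
        have h3 := inj heq
        rw [Prod.mk.injEq, Prod.mk.injEq, List.append_nil] at h3
        have h4 := h3.2.1
        have h5 := decideDiverse_iff (Pb := Pb) (l := l) (pos := K'.reverse) hτ I hI (by
          intro k
          rw [h4, List.mem_reverse, List.mem_filter, decide_eq_true_eq]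
          simp only [Input.keys, hx, hL])
        simp only [hx, ← hL] at h5 ⊢
        cases hd : decideDiverse K'.reverse L (2 ^ l) l with
        | false => exact .inr ⟨fun h => by simp [h5.2 h] at hd, rfl⟩
        | true => exact .inl ⟨h5.1 hd, rfl⟩)
    have hall := (MC.of_det (S := fun d => d = _) (G := fun d => d = _) hfirst rfl rfl).seq
      (S' := fun _ => True) (G' := IsDiverseAnswer Pb I l) (by
        rintro _ rfl
        exact hlast.mono (fun _ h => h) (fun _ h _ => h) le_rfl le_rfl)
    refine hall.mono (fun _ h => h) (fun _ h => h) (by simp) ?_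
    have hlen : (x.keys.length : ℝ≥0) ≤ sz x.keys := by exact_mod_cast length_le_sz x.keys
    push_cast
    generalize (tpow x : ℝ≥0) + tprep x + (11 * sz (prepare x) + 80) = t₀
    generalize ((sz x.keys : ℝ≥0) + 1) ^ ccode = tc
    generalize ((sz x : ℝ≥0) + sz x.keys + 1 + 1) ^ cdp = td
    generalize (x.keys.length : ℝ≥0) = len at hlen ⊢
    generalize (sz x.keys : ℝ≥0) = κ at hlen ⊢
    have h1 : len * (T + tc + 80) ≤ κ * ((tc + 80) * (T + 1)) := by
      refine mul_le_mul' hlen ?_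
      rw [show (tc + 80) * (T + 1) = T + tc + 80 + (tc * T + 79 * T) by ring]
      exact le_self_add
    calc t₀ + (len * (T + tc + 80) + 5 + (td + 12) + 1) + 1
        ≤ t₀ + (κ * ((tc + 80) * (T + 1)) + 5 + (td + 12) + 1) + 1 := by gcongr
      _ ≤ t₀ + (κ * ((tc + 80) * (T + 1)) + 5 + (td + 12) + 1) + 1 + (6 + (t₀ + td + 25) * T) :=
        le_self_add
      _ = (t₀ + (κ * (tc + 80) + 5) + (td + 20)) * (T + 1) := by ring

end DiverseMultistage

open DiverseMultistage in
theorem theorem2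
    (Pb : DiverseMultistage.Problem) (r : DiverseMultistage.Inst → ℕ)
    (f : ℕ → ℝ≥0) (hf : Monotone f)
    (D : Set ℝ) (hD : D ⊆ Set.Icc 0 1)
    (hDup : ∀ p ∈ D, ∀ q : ℝ, p ≤ q → q ≤ 1 → q ∈ D)
    (g : ℝ → ℝ≥0) (hg : AntitoneOn g D)
    (hA : ∃ (A : DiverseMultistage.Prog) (a : ℕ),
      ∀ p ∈ D, ∀ I ∈ Pb.instances, ∀ (c : DiverseMultistage.Data → Fin 4) (n : Fin 4 → ℕ),
        DiverseMultistage.MonteCarlo A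
          (DiverseMultistage.Data.cons (DiverseMultistage.coloredCode I c n)
            (DiverseMultistage.errorCode p))
          (DiverseMultistage.IsColoredAnswer Pb I c n) p
          (f (r I) * ((DiverseMultistage.coloredCode I c n).size : ℝ≥0) ^ a * g p)) :
    ∃ (M : DiverseMultistage.Prog) (C₁ c₁ C₂ c₂ : ℕ),
      ∀ (τ : ℕ) (I : Fin τ → DiverseMultistage.Inst) (l n : ℕ) (p : ℝ),
        0 < τ → (∀ i, I i ∈ Pb.instances) →
        n = (DiverseMultistage.multistageCode I l).size →
        0 ≤ p → p ≤ 1 →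
        p / ((τ : ℝ) * 2 ^ (C₂ * l) * (n : ℝ) ^ c₂) ∈ D →
        DiverseMultistage.MonteCarlo M
          (DiverseMultistage.Data.cons (DiverseMultistage.multistageCode I l)
            (DiverseMultistage.errorCode p))
          (DiverseMultistage.IsDiverseAnswer Pb I l) p
          (2 ^ (C₁ * l) * f (Finset.univ.sup fun i => r (I i)) * (n : ℝ≥0) ^ c₁ *
            g (p / ((τ : ℝ) * 2 ^ (C₂ * l) * (n : ℝ) ^ c₂))) := by
  obtain ⟨A, a, hA⟩ := hA
  obtain ⟨M, W, B, N, hW, hB, hN, hNx, hWx, hM⟩ := exists_mainProg A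
  obtain ⟨C₁, hC₁⟩ := (hB.mul (((PB.const 2).mul (hW.pow a)))).le_pow
  obtain ⟨C₂, hC₂⟩ := hN.le_pow
  refine ⟨M, C₁, 3 * C₁, C₂, 3 * C₂, fun τ I l n p hτ hI hn hp0 hp1 hpD => ?_⟩
  set L : List Item := List.ofFn fun i => (I i).item with hL
  set x : Input := ((L, l), 2 ^ l) with hx
  replace hn : n = sz (L, l) := by rw [hn, multistageCode_eq]; rfl
  set F : ℝ≥0 := f (Finset.univ.sup fun i => r (I i)) with hF
  set p' : ℝ := p / ((τ : ℝ) * 2 ^ (C₂ * l) * (n : ℝ) ^ (3 * C₂)) with hp'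
  set m := logBound x.keys.length with hm
  obtain ⟨q, hq0, hq1, hqp, hpq, hlow⟩ := exists_lower m hp0 hp1
  have hkeysτ : ∀ k ∈ x.keys, ∃ i, k.1 = (I i).item := by
    intro k hk
    obtain ⟨i, hi⟩ := List.mem_ofFn.1 (fst_mem_of_mem_allKeys hk)
    exact ⟨i, hi.symm⟩
  have hnpos : 1 ≤ n := hn ▸ sz_pos _
  -- the error bound for a single call is at least the argument of `g`
  have hp'q : p' ≤ q := by
    have h1 : (2 * 2 ^ m : ℝ) ≤ 2 ^ (C₂ * l) * (n : ℝ) ^ (3 * C₂) := by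
      have := (hNx x).trans (hC₂ L l)
      rw [← hn] at this
      exact_mod_cast this
    have h2 : (1 : ℝ) ≤ τ := by exact_mod_cast hτ
    have hnpos' : (0 : ℝ) < n := by exact_mod_cast hnpos
    rw [hp', div_le_iff₀ (by positivity)]
    calc p ≤ 2 * 2 ^ m * q := hpq
      _ ≤ 2 ^ (C₂ * l) * (n : ℝ) ^ (3 * C₂) * q := by gcongr
      _ = q * (1 * 2 ^ (C₂ * l) * (n : ℝ) ^ (3 * C₂)) := by ring
      _ ≤ q * (τ * 2 ^ (C₂ * l) * (n : ℝ) ^ (3 * C₂)) := by gcongr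
  have hqD : q ∈ D := hDup p' hpD q hp'q hq1
  have hgq : g q ≤ g p' := hg hpD hqD hp'q
  set T : ℝ≥0 := F * (W x : ℝ≥0) ^ a * g p' with hT
  have hcall : ∀ k ∈ x.keys, MonteCarlo A (.cons k.code (errorCode q))
      (fun out => out ≠ .nil ↔ k.Solvable Pb) q T := by
    intro k hk
    obtain ⟨i, hi⟩ := hkeysτ k hk
    have h := hA q hqD (I i) (hI i) (color k.2.1.1 k.2.1.2) k.counts
    rw [← Key.code_eq k (I i) hi] at h
    have hle : f (r (I i)) * (k.code.size : ℝ≥0) ^ a * g q ≤ T := by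
      have h1 : f (r (I i)) ≤ F := hf (Finset.le_sup (f := fun i => r (I i)) (Finset.mem_univ i))
      have h2 : (k.code.size : ℝ≥0) ≤ W x := by exact_mod_cast hWx x k hk
      rw [hT]; gcongr
    refine MC.monteCarlo hq0 (h.mc.mono (fun _ h => h) (fun out hout => ?_) le_rfl hle)
    rw [isColoredAnswer_iff hout]
    constructor
    · rintro ⟨S, hS⟩; exact ⟨I i, S, hi.symm, hS⟩
    · rintro ⟨I', S, hI', hS⟩
      obtain rfl : I' = I i := Inst.item_injective (hI'.trans hi)
      exact ⟨S, hS⟩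
  -- a call takes at least one step, so that all other costs are dominated as well
  have hT1 : 1 ≤ T := by
    have hne : L ≠ [] := by
      rw [hL, Ne, List.ofFn_eq_nil_iff]; omega
    obtain ⟨k, hk⟩ := List.exists_mem_of_ne_nil _ (allKeys_ne_nil hne (2 ^ l))
    exact (hcall k hk).one_le
  have hmain := hM Pb τ I l (errorCode p) (errorCode q) (ENNReal.ofReal q) T x rfl hτ hI hlow
    fun k hk => (hcall k hk).mc
  refine MC.monteCarlo hp0 (hmain.mono (fun _ h => h) (fun _ h => h) ?_ ?_)
  · rw [← ENNReal.ofReal_natCast, ← ENNReal.ofReal_mul (by positivity)]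
    refine ENNReal.ofReal_le_ofReal (le_trans ?_ hqp)
    have : (x.keys.length : ℝ) ≤ 2 ^ m := by exact_mod_cast (logBound_spec x.keys.length).1
    gcongr
  · have h1 : (B x : ℝ≥0) * (2 * (W x : ℝ≥0) ^ a) ≤ 2 ^ (C₁ * l) * (n : ℝ≥0) ^ (3 * C₁) := by
      have := hC₁ L l
      rw [← hn] at this
      exact_mod_cast this
    calc (B x : ℝ≥0) * (T + 1) ≤ B x * (T + T) := by gcongr
      _ = B x * (2 * (W x : ℝ≥0) ^ a) * (F * g p') := by rw [hT]; ring
      _ ≤ 2 ^ (C₁ * l) * (n : ℝ≥0) ^ (3 * C₁) * (F * g p') := by gcongr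
      _ = _ := by ring
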